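/- **Setting.** Consider the $\{6,4\}$ tiling of the hyperbolic plane (four right-angled hexagons around each vertex) and a finite patch of hexagons of this tiling. Let $\chi=2^\nu$. On each hexagon of the patch place a gate acting on three $\chi$-state qudits, i.e. a $\chi^3\times\chi^3$ matrix whose three incoming and three outgoing legs sit on the six sides of the hexagon. Two hexagons of the patch sharing a side are joined by a bond of dimension $\chi$: either an outgoing leg of one gate is an incoming leg of the other (a qudit travelling from one gate to the other), or both legs are incoming and are fed by the two halves of a Bell pair $\chi^{-1/2}\sum_j|jj\rangle$; two outgoing legs are never joined, and the gates can be ordered in time so that every outgoing leg that stays in the patch enters a later gate. The $L$ sides on the boundary of the patch carry the output qudits: an outgoing leg there is itself an output qudit, and an incoming leg there is fed by one half of a Bell pair whose other half is the output qudit. Contracting the network gives a pure state of $L$ qudits of dimension $\chi$, i.e. of $N=L\log_2\chi$ qubits. The gates are drawn independently from the PFC ensemble: each is a product $PFC$ of a permutation $P$ of the $3\nu$-qubit computational basis, a diagonal operator $F$ of binary phases $\pm1$, and a uniformly random Clifford unitary $C$ on $3\nu$ qubits, with $P$, $F$ and $C$ independent; $P$ and $F$ may have any laws, for instance pseudorandom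 ones (the same laws for every gate). For a set $A$ of output qudits let $S(A)=-\operatorname{tr}(\rho_A\log\rho_A)$ be its entanglement entropy, and let $|\gamma_A|$ be the minimum number of bonds (the $L$ dangling ones included) that have to be cut to separate $A$ from the other output qudits in the network. **Theorem.** As $N\to\infty$ with $\chi$ growing faster than every power of $N$, for any set $A$ of output qudits $$\mathbb{E}[S(A)]=|\gamma_A|\,\log\chi\,\bigl[1+o(1)\bigr]+O(N/\chi),$$ uniformly in the network, in the laws of $P$ and $F$, and in $A$. That is: there is a constant $K$ such that for every $\varepsilon>0$ there is $M\in\mathbb{N}$ such that, for every network and every $\nu$ with $N\ge M$ and $\chi\ge N^M$, all laws of $P$ and $F$, and every $A$, one has $\mathbb{E}[S(A)]=|\gamma_A|\log\chi\,(1+\delta)+r$ for some real $\delta,r$ with $|\delta|\le\varepsilon$ and $|r|\le K N/\chi$. -/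

import Mathlib

noncomputable section

open Matrix Finset

/-! ### Qubit registers, the Pauli group and the Clifford group -/

/-- Computational basis states of a register of qubits labelled by `ι`. -/
abbrev Bits (ι : Type) : Type := ι → ZMod 2

/-- The sign `(-1)^t`. -/
def sgn (t : ZMod 2) : ℂ := if t = 0 then 1 else -1

/-- The Pauli string `X^a Z^b`, which maps `|y⟩` to `(-1)^(b ⬝ y) |y + a⟩`. -/
def pauli {ι : Type} [Fintype ι] [DecidableEq ι] (a b : Bits ι) : Matrix (Bits ι) (Bits ι) ℂ :=
  Matrix.of fun x y => if x = y + a then sgn (b ⬝ᵥ y) else 0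

theorem sgn_add (s t : ZMod 2) : sgn (s + t) = sgn s * sgn t := by
  have h : ∀ s t : ZMod 2, (s + t = 0 ↔ (s = 0 ↔ t = 0)) := by decide
  unfold sgn
  by_cases hs : s = 0 <;> by_cases ht : t = 0 <;> simp [h, hs, ht]

theorem sgn_eq_pow (s : ZMod 2) : sgn s = Complex.I ^ (2 * s.val) := by
  have h : ∀ s : ZMod 2, s = 0 ∨ s = 1 := by decide
  rcases h s with rfl | rfl
  · simp [sgn]
  · simp [sgn, ZMod.val_one]

theorem bits_add_self {ι : Type} (a : Bits ι) : a + a = 0 := by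
  funext q
  exact CharTwo.add_self_eq_zero (a q)

theorem pauli_mul {ι : Type} [Fintype ι] [DecidableEq ι] (a b a' b' : Bits ι) :
    pauli a b * pauli a' b' = sgn (b ⬝ᵥ a') • pauli (a + a') (b + b') := by
  ext x y
  simp only [Matrix.mul_apply, pauli, Matrix.of_apply, Matrix.smul_apply, smul_eq_mul]
  rw [Finset.sum_eq_single (y + a')]
  · have h : y + a' + a = y + (a + a') := by abel
    by_cases hx : x = y + (a + a')
    · simp only [h, hx, if_true, dotProduct_add, add_dotProduct, sgn_add]
      ring
    · simp [h, hx]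
  · intro z _ hz
    simp [hz]
  · simp

/-- The Pauli group on the qubits `ι`: all `i^k X^a Z^b`. -/
def pauliGroup (ι : Type) [Fintype ι] [DecidableEq ι] : Subgroup (Matrix.unitaryGroup (Bits ι) ℂ) where
  carrier := {U | ∃ (k : ℕ) (a b : Bits ι),
    (U : Matrix (Bits ι) (Bits ι) ℂ) = Complex.I ^ k • pauli a b}
  one_mem' := by
    refine ⟨0, 0, 0, ?_⟩
    ext x y
    simp [pauli, sgn, Matrix.one_apply]
  mul_mem' := by
    rintro U V ⟨k, a, b, hU⟩ ⟨l, a', b', hV⟩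
    refine ⟨k + l + 2 * (b ⬝ᵥ a').val, a + a', b + b', ?_⟩
    rw [Matrix.UnitaryGroup.mul_val, hU, hV, Matrix.smul_mul, Matrix.mul_smul, pauli_mul,
      sgn_eq_pow, smul_smul, smul_smul, pow_add, pow_add]
  inv_mem' := by
    rintro U ⟨k, a, b, hU⟩
    have key : (Complex.I ^ (3 * k) * sgn (b ⬝ᵥ a)) • (pauli a b * (U : Matrix _ _ ℂ)) = 1 := by
      rw [hU, Matrix.mul_smul, pauli_mul, bits_add_self, bits_add_self, smul_smul, smul_smul]
      have h1 : sgn (b ⬝ᵥ a) * sgn (b ⬝ᵥ a) = 1 := by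
        unfold sgn; split_ifs <;> norm_num
      have h2 : Complex.I ^ (3 * k) * Complex.I ^ k = 1 := by
        rw [← pow_add, show 3 * k + k = 4 * k by ring, pow_mul, Complex.I_pow_four, one_pow]
      have h3 : Complex.I ^ (3 * k) * sgn (b ⬝ᵥ a) * Complex.I ^ k * sgn (b ⬝ᵥ a) = 1 := by
        linear_combination h2 * (sgn (b ⬝ᵥ a) * sgn (b ⬝ᵥ a)) + h1
      rw [h3]
      ext x y
      simp [pauli, sgn, Matrix.one_apply]
    refine ⟨3 * k + 2 * (b ⬝ᵥ a).val, a, b, ?_⟩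
    rw [pow_add, ← sgn_eq_pow]
    have hUU : (U : Matrix (Bits ι) (Bits ι) ℂ) * ((U⁻¹ : Matrix.unitaryGroup (Bits ι) ℂ) :
        Matrix (Bits ι) (Bits ι) ℂ) = 1 := by
      rw [← Matrix.UnitaryGroup.mul_val, mul_inv_cancel, Matrix.UnitaryGroup.one_val]
    rw [← Matrix.smul_mul] at key
    exact (left_inv_eq_right_inv key hUU).symm

/-- The Clifford group: the unitaries that normalize the Pauli group. -/
def cliffordGroup (ι : Type) [Fintype ι] [DecidableEq ι] : Subgroup (Matrix.unitaryGroup (Bits ι) ℂ) :=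
  Subgroup.normalizer (pauliGroup ι : Set (Matrix.unitaryGroup (Bits ι) ℂ))

/-- The determinant-one Clifford unitaries. They form a finite group, every Clifford unitary is a
phase times one of them, and every class of Clifford unitaries modulo phases has the same number of
representatives in it; so, global phases being immaterial, a uniformly random Clifford unitary is a
uniformly random element of this group. -/
def specialCliffordGroup (ι : Type) [Fintype ι] [DecidableEq ι] :
    Subgroup (Matrix.unitaryGroup (Bits ι) ℂ) :=
  cliffordGroup ι ⊓
    (Matrix.detMonoidHom.comp (Matrix.unitaryGroup (Bits ι) ℂ).subtype).ker

theorem finite_pauliGroup (ι : Type) [Fintype ι] [DecidableEq ι] : Finite (pauliGroup ι) := by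
  have hfin : (Set.range fun t : Fin 4 × Bits ι × Bits ι =>
      Complex.I ^ (t.1 : ℕ) • pauli t.2.1 t.2.2).Finite := Set.finite_range _
  have : Finite ↥(Set.range fun t : Fin 4 × Bits ι × Bits ι =>
      Complex.I ^ (t.1 : ℕ) • pauli t.2.1 t.2.2) := hfin
  refine Finite.of_injective (fun U : pauliGroup ι =>
    (⟨(U.1 : Matrix (Bits ι) (Bits ι) ℂ), ?_⟩ : ↥(Set.range fun t : Fin 4 × Bits ι × Bits ι =>
      Complex.I ^ (t.1 : ℕ) • pauli t.2.1 t.2.2))) ?_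
  · obtain ⟨k, a, b, h⟩ := U.2
    refine ⟨(⟨k % 4, Nat.mod_lt _ (by norm_num)⟩, a, b), ?_⟩
    change Complex.I ^ (k % 4) • pauli a b = _
    rw [h, ← Complex.I_pow_eq_pow_mod]
  · intro U V h
    exact Subtype.ext (Subtype.ext (congrArg Subtype.val h :))

theorem pauli_unitary {ι : Type} [Fintype ι] [DecidableEq ι] (a b : Bits ι) :
    pauli a b ∈ Matrix.unitaryGroup (Bits ι) ℂ := by
  have hstar : star (pauli a b) = sgn (b ⬝ᵥ a) • pauli a b := by
    ext x y
    have hc : (starRingEnd ℂ) (sgn (b ⬝ᵥ x)) = sgn (b ⬝ᵥ x) := by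
      unfold sgn; split_ifs <;> simp
    simp only [Matrix.star_apply, pauli, Matrix.of_apply, Matrix.smul_apply, smul_eq_mul]
    by_cases h : y = x + a
    · have h' : x = y + a := by rw [h, add_assoc, bits_add_self, add_zero]
      rw [if_pos h, if_pos h']
      have : sgn (b ⬝ᵥ a) * sgn (b ⬝ᵥ y) = sgn (b ⬝ᵥ x) := by
        rw [← sgn_add, ← dotProduct_add, add_comm a y, ← h']
      rw [this]
      exact hc
    · have h' : ¬ x = y + a := fun e => h (by rw [e, add_assoc, bits_add_self, add_zero])
      rw [if_neg h, if_neg h']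
      simp
  rw [Matrix.mem_unitaryGroup_iff', hstar, Matrix.smul_mul, pauli_mul, bits_add_self,
    bits_add_self, smul_smul]
  have h1 : sgn (b ⬝ᵥ a) * sgn (b ⬝ᵥ a) = 1 := by
    unfold sgn; split_ifs <;> norm_num
  rw [h1]
  ext x y
  simp [pauli, sgn, Matrix.one_apply]

/-- A matrix that commutes with every Pauli string is scalar. -/
theorem scalar_of_commute_pauli {ι : Type} [Fintype ι] [DecidableEq ι] (U : Matrix (Bits ι) (Bits ι) ℂ)
    (h : ∀ a b : Bits ι, U * pauli a b = pauli a b * U) :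
    U = U 0 0 • (1 : Matrix (Bits ι) (Bits ι) ℂ) := by
  have hl : ∀ a b x y : Bits ι, (U * pauli a b) x y = U x (y + a) * sgn (b ⬝ᵥ y) := by
    intro a b x y
    simp [Matrix.mul_apply, pauli]
  have hr : ∀ a b x y : Bits ι, (pauli a b * U) x y = sgn (b ⬝ᵥ (x + a)) * U (x + a) y := by
    intro a b x y
    rw [Matrix.mul_apply, Finset.sum_eq_single (x + a)]
    · simp [pauli, add_assoc, bits_add_self]
    · intro z _ hz
      have : ¬ x = z + a := fun e => hz (by rw [e, add_assoc, bits_add_self, add_zero])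
      simp [pauli, this]
    · simp
  ext x y
  rw [Matrix.smul_apply, Matrix.one_apply]
  by_cases hxy : x = y
  · subst hxy
    have := congrFun (congrFun (h x 0) x) 0
    rw [hl, hr] at this
    simpa [sgn, bits_add_self] using this
  · obtain ⟨q, hq⟩ := Function.ne_iff.mp hxy
    have := congrFun (congrFun (h 0 (Pi.single q 1)) x) y
    rw [hl, hr] at this
    simp only [add_zero, single_dotProduct, one_mul] at this
    have hs : sgn (x q) ≠ sgn (y q) := by
      have h2 : ∀ s t : ZMod 2, s ≠ t → ((s = 0 ∧ t ≠ 0) ∨ (s ≠ 0 ∧ t = 0)) := by decide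
      rcases h2 _ _ hq with ⟨h3, h4⟩ | ⟨h3, h4⟩
      · rw [sgn, sgn, if_pos h3, if_neg h4]; norm_num
      · rw [sgn, sgn, if_neg h3, if_pos h4]; norm_num
    have h0 : U x y * (sgn (x q) - sgn (y q)) = 0 := by linear_combination -this
    have : U x y = 0 := (mul_eq_zero.mp h0).resolve_right (sub_ne_zero.mpr hs)
    simp [hxy, this]

instance finite_specialCliffordGroup (ι : Type) [Fintype ι] [DecidableEq ι] :
    Finite (specialCliffordGroup ι) := by
  have := finite_pauliGroup ι
  let φ : specialCliffordGroup ι →* MulAut (pauliGroup ι) :=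
    (pauliGroup ι).normalizerMonoidHom.comp (Subgroup.inclusion inf_le_left)
  have hA : Finite (MulAut (pauliGroup ι)) :=
    Finite.of_injective (fun e : MulAut (pauliGroup ι) => (e : pauliGroup ι → pauliGroup ι))
      DFunLike.coe_injective
  have hq : Finite (specialCliffordGroup ι ⧸ φ.ker) :=
    Finite.of_injective _ (QuotientGroup.kerLift_injective φ)
  have hd : 0 < Fintype.card (Bits ι) := Fintype.card_pos
  have hs : ∀ U : φ.ker, (U.1.1 : Matrix (Bits ι) (Bits ι) ℂ) =
      (U.1.1 : Matrix (Bits ι) (Bits ι) ℂ) 0 0 • (1 : Matrix (Bits ι) (Bits ι) ℂ) := by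
    intro U
    apply scalar_of_commute_pauli
    intro a b
    let P : pauliGroup ι := ⟨⟨pauli a b, pauli_unitary a b⟩, 0, a, b, by simp⟩
    have h1 : φ U.1 = 1 := MonoidHom.mem_ker.mp U.2
    have h2 : (φ U.1) P = P := by rw [h1]; rfl
    have h3 : U.1.1 * P.1 * (U.1.1)⁻¹ = P.1 := congrArg Subtype.val h2
    have h4 : U.1.1 * P.1 = P.1 * U.1.1 := by
      rw [mul_inv_eq_iff_eq_mul] at h3
      exact h3
    exact congrArg Subtype.val h4
  have hr : ∀ U : φ.ker, (U.1.1 : Matrix (Bits ι) (Bits ι) ℂ) 0 0 ∈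
      {z : ℂ | z ^ Fintype.card (Bits ι) = 1} := by
    intro U
    have hdet : (U.1.1 : Matrix (Bits ι) (Bits ι) ℂ).det = 1 := U.1.2.2
    rw [hs U, Matrix.det_smul, Matrix.det_one, mul_one] at hdet
    exact hdet
  have hfin : {z : ℂ | z ^ Fintype.card (Bits ι) = 1}.Finite := by
    refine (Polynomial.nthRootsFinset (Fintype.card (Bits ι)) (1 : ℂ)).finite_toSet.subset ?_
    intro z hz
    exact (Polynomial.mem_nthRootsFinset hd 1).mpr hz
  have : Finite ↥{z : ℂ | z ^ Fintype.card (Bits ι) = 1} := hfin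
  have hk : Finite φ.ker := by
    refine Finite.of_injective (fun U : φ.ker =>
      (⟨_, hr U⟩ : ↥{z : ℂ | z ^ Fintype.card (Bits ι) = 1})) ?_
    intro U V h
    have h' : (U.1.1 : Matrix (Bits ι) (Bits ι) ℂ) 0 0 = (V.1.1 : Matrix (Bits ι) (Bits ι) ℂ) 0 0 :=
      Subtype.ext_iff.mp h
    refine Subtype.ext (Subtype.ext (Subtype.ext ?_))
    rw [hs U, hs V, h']
  exact Finite.of_subgroup_quotient φ.ker

instance fintype_specialCliffordGroup (ι : Type) [Fintype ι] [DecidableEq ι] :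
    Fintype (specialCliffordGroup ι) := Fintype.ofFinite _

/-! ### PFC gates -/

/-- The permutation operator `P|x⟩ = |π x⟩`. -/
def permOp {ι : Type} [Fintype ι] [DecidableEq ι] (π : Equiv.Perm (Bits ι)) : Matrix (Bits ι) (Bits ι) ℂ :=
  Matrix.of fun x y => if x = π y then 1 else 0

/-- The binary phase operator `F|x⟩ = (-1)^(f x) |x⟩`. -/
def phaseOp {ι : Type} [Fintype ι] [DecidableEq ι] (f : Bits ι → ZMod 2) : Matrix (Bits ι) (Bits ι) ℂ :=
  Matrix.diagonal fun x => sgn (f x)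

/-- The PFC gate: the Clifford unitary `c`, then the binary phase `f`, then the permutation `π`. -/
def pfcGate {ι : Type} [Fintype ι] [DecidableEq ι] (π : Equiv.Perm (Bits ι)) (f : Bits ι → ZMod 2)
    (c : specialCliffordGroup ι) : Matrix (Bits ι) (Bits ι) ℂ :=
  permOp π * phaseOp f * (c.1 : Matrix (Bits ι) (Bits ι) ℂ)

/-! ### The {6,4} tiling -/

/-- The Coxeter matrix of the group generated by the reflections in the sides of a regular
right-angled hexagon: reflections in consecutive sides commute, and there is no relation (entry
`0`, that is infinite order) between reflections in sides that are not consecutive. -/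
def hexagonCoxeter : CoxeterMatrix (Fin 6) where
  M := Matrix.of fun i j => if i = j then 1 else if i = j + 1 ∨ j = i + 1 then 2 else 0
  isSymm := by decide
  diagonal := by decide
  off_diagonal i i' h := by
    simp only [Matrix.of_apply, if_neg h]
    split_ifs <;> norm_num

/-- The hexagons of the {6,4} tiling of the hyperbolic plane (four right-angled hexagons around each
vertex). The reflection group of a right-angled hexagon acts simply transitively on them, so they
are labelled by its elements. -/
abbrev Hexagon : Type := hexagonCoxeter.Group

/-- The hexagon on the other side of side `i` of the hexagon `v`. -/
def neighbor (v : Hexagon) (i : Fin 6) : Hexagon := v * hexagonCoxeter.simple i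

open scoped Classical

/-! ### Entanglement entropy -/

/-- The reduced density matrix, on the sites in `A`, of the pure state with amplitudes `ψ` on sites
labelled by `L` with local basis `Q`. -/
def reducedDensity {L Q : Type} [Fintype L] [Fintype Q] (ψ : (L → Q) → ℂ) (A : Finset L) :
    Matrix ({l // l ∈ A} → Q) ({l // l ∈ A} → Q) ℂ :=
  Matrix.of fun a a' => ∑ b : {l // ¬ l ∈ A} → Q,
    ψ ((Equiv.piEquivPiSubtypeProd (fun l => l ∈ A) fun _ => Q).symm (a, b)) *
      star (ψ ((Equiv.piEquivPiSubtypeProd (fun l => l ∈ A) fun _ => Q).symm (a', b)))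

theorem reducedDensity_isHermitian {L Q : Type} [Fintype L] [Fintype Q] (ψ : (L → Q) → ℂ)
    (A : Finset L) : (reducedDensity ψ A).IsHermitian := by
  ext a a'
  simp [reducedDensity, Matrix.conjTranspose_apply, mul_comm]

/-- The von Neumann entropy `S(A) = - tr (ρ_A log ρ_A)`, with the natural logarithm. -/
def entanglementEntropy {L Q : Type} [Fintype L] [Fintype Q] (ψ : (L → Q) → ℂ)
    (A : Finset L) : ℝ :=
  ∑ k, Real.negMulLog ((reducedDensity_isHermitian ψ A).eigenvalues k)

/-! ### Holographic tensor networks -/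

/-- A circuit on a finite patch of the {6,4} tiling. Each hexagon carries a gate from three qudits
to three qudits, whose six legs sit on the six sides: `leg v (Sum.inl k)` is the side of the `k`-th
incoming qudit and `leg v (Sum.inr k)` that of the `k`-th outgoing one. Two hexagons of the patch
that share a side are joined by a bond through that side: side `i` of `v` is side `i` of
`neighbor v i`. If one end of the bond is outgoing and the other incoming, a qudit travels from one
gate to the other; if both are incoming, the bond is a Bell pair that feeds both gates.
The gates can be applied in the order given by `time`: an outgoing leg that does not leave the patch
enters a later gate. -/
structure HoloNetwork where
  patch : Finset Hexagon
  leg : Hexagon → Fin 3 ⊕ Fin 3 ≃ Fin 6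
  time : Hexagon → ℕ
  causal : ∀ v ∈ patch, ∀ k : Fin 3, neighbor v (leg v (Sum.inr k)) ∈ patch →
    (∃ k' : Fin 3, leg (neighbor v (leg v (Sum.inr k))) (Sum.inl k') = leg v (Sum.inr k)) ∧
      time v < time (neighbor v (leg v (Sum.inr k)))

namespace HoloNetwork

/-- The legs of the gates of the network: a hexagon of the patch and one of its sides. -/
abbrev Leg (T : HoloNetwork) : Type := {v // v ∈ T.patch} × Fin 6

/-- The dangling legs, through the sides on the boundary of the patch. They are the output qudits;
a dangling leg that is incoming to its gate is fed with one half of a Bell pair whose other half is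
the output qudit. -/
abbrev Output (T : HoloNetwork) : Type := {l : T.Leg // neighbor l.1.1 l.2 ∉ T.patch}

/-- The leg is incoming to its gate. -/
def IsInput (T : HoloNetwork) (l : T.Leg) : Prop := ∃ k : Fin 3, T.leg l.1.1 (Sum.inl k) = l.2

/-- The leg receives one half of a Bell pair: it is incoming, and at the other end of its side there
is either the outside of the patch or another incoming leg. -/
def IsBell (T : HoloNetwork) (l : T.Leg) : Prop :=
  T.IsInput l ∧ ∀ h : neighbor l.1.1 l.2 ∈ T.patch, T.IsInput (⟨neighbor l.1.1 l.2, h⟩, l.2)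

/-- The number of input Bell pairs (sides of the tiling, written as unordered pairs of a hexagon and
its neighbor, together with the label of the side). -/
def numBell (T : HoloNetwork) : ℕ :=
  ((univ.filter T.IsBell).image fun l => (s(l.1.1, neighbor l.1.1 l.2), l.2)).card

/-- The number of qubits `N`: each output qudit of dimension `χ = 2 ^ ν` counts for `ν` qubits. -/
def numQubits (T : HoloNetwork) (ν : ℕ) : ℕ := Fintype.card T.Output * ν

/-- Basis states of a qudit of dimension `2 ^ ν`, seen as `ν` qubits. -/
abbrev Qudit (ν : ℕ) : Type := Bits (Fin ν)

/-- The `3 ν` qubits on which a gate acts. -/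
abbrev GateQubits (ν : ℕ) : Type := Fin 3 × Fin ν

/-- The two ends of each bond carry the same basis state. -/
def Glued (T : HoloNetwork) {ν : ℕ} (y : T.Leg → Qudit ν) : Prop :=
  ∀ (l : T.Leg) (h : neighbor l.1.1 l.2 ∈ T.patch), y (⟨neighbor l.1.1 l.2, h⟩, l.2) = y l

/-- The basis state of the three incoming qudits of the gate on `v`. -/
def inState (T : HoloNetwork) {ν : ℕ} (y : T.Leg → Qudit ν) (v : {v // v ∈ T.patch}) :
    Bits (GateQubits ν) := fun q => y (v, T.leg v (Sum.inl q.1)) q.2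

/-- The basis state of the three outgoing qudits of the gate on `v`. -/
def outState (T : HoloNetwork) {ν : ℕ} (y : T.Leg → Qudit ν) (v : {v // v ∈ T.patch}) :
    Bits (GateQubits ν) := fun q => y (v, T.leg v (Sum.inr q.1)) q.2

/-- The tensor network state of the output qudits: the contraction of the gates `U v` over all
bonds, with a factor `1 / √χ` for each Bell pair `(1 / √χ) ∑ j, |j j⟩`. -/
def state (T : HoloNetwork) {ν : ℕ}
    (U : {v // v ∈ T.patch} → Matrix (Bits (GateQubits ν)) (Bits (GateQubits ν)) ℂ)
    (x : T.Output → Qudit ν) : ℂ :=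
  ((1 / √((2 : ℝ) ^ ν) : ℝ) : ℂ) ^ T.numBell *
    ∑ y : T.Leg → Qudit ν with T.Glued y ∧ ∀ l : T.Output, y l.1 = x l,
      ∏ v, U v (T.outState y v) (T.inState y v)

/-- The expected entanglement entropy of the output qudits `A`, over independent PFC gates on the
hexagons, in each of which the permutation has law `P`, the phase function has law `F`, and the
Clifford unitary is uniformly random, all three independent. -/
def expectedEntropy (T : HoloNetwork) {ν : ℕ} (P : PMF (Equiv.Perm (Bits (GateQubits ν))))
    (F : PMF (Bits (GateQubits ν) → ZMod 2)) (A : Finset T.Output) : ℝ :=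
  ∑ π : {v // v ∈ T.patch} → Equiv.Perm (Bits (GateQubits ν)),
  ∑ f : {v // v ∈ T.patch} → Bits (GateQubits ν) → ZMod 2,
  ∑ c : {v // v ∈ T.patch} → specialCliffordGroup (GateQubits ν),
    (∏ v, (P (π v)).toReal * (F (f v)).toReal *
      (1 / (Fintype.card (specialCliffordGroup (GateQubits ν)) : ℝ))) *
      entanglementEntropy (T.state fun v => pfcGate (π v) (f v) (c v)) A

/-- The number of bonds cut by the curve that separates the hexagons in `R` (and the dangling legs
in `A`) from the other hexagons of the patch (and the other dangling legs). -/
def cutSize (T : HoloNetwork) (A : Finset T.Output) (R : Finset {v // v ∈ T.patch}) : ℕ :=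
  (univ.filter fun l : T.Leg =>
      l.1 ∈ R ∧ ∃ h : neighbor l.1.1 l.2 ∈ T.patch, ⟨neighbor l.1.1 l.2, h⟩ ∉ R).card +
    (univ.filter fun l : T.Output => ¬ (l ∈ A ↔ l.1.1 ∈ R)).card

/-- `|γ_A|`: the smallest number of bonds cut by a curve that separates the output qudits in `A`
from the others. -/
def minCut (T : HoloNetwork) (A : Finset T.Output) : ℕ :=
  ⨅ R : Finset {v // v ∈ T.patch}, T.cutSize A R

end HoloNetwork

end

noncomputable section

open Matrix Finset
open scoped Classical ComplexOrder Kronecker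

/-! ### Entropy bounds for positive matrices -/

section Entropy

variable {n : Type*} [Fintype n]

theorem Matrix.IsHermitian.trace_mul_self_eq_sum_eigenvalues [DecidableEq n] {A : Matrix n n ℂ}
    (hA : A.IsHermitian) : (A * A).trace = ((∑ k, hA.eigenvalues k ^ 2 : ℝ) : ℂ) := by
  have h := hA.spectral_theorem
  set D : Matrix n n ℂ := diagonal (RCLike.ofReal ∘ hA.eigenvalues) with hD
  have h2 : A * A = Unitary.conjStarAlgAut ℂ _ hA.eigenvectorUnitary (D * D) := by
    rw [map_mul, ← h]
  rw [h2, Unitary.conjStarAlgAut_apply, Matrix.trace_mul_comm, ← mul_assoc,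
    Unitary.coe_star_mul_self, one_mul, hD, diagonal_mul_diagonal, trace_diagonal]
  push_cast
  exact Finset.sum_congr rfl fun k _ => by simp [sq]

theorem mul_tangent_le_negMulLog {x t : ℝ} (hx : 0 ≤ x) (ht : 0 < t) :
    (1 - Real.log t) * x - x ^ 2 / t ≤ Real.negMulLog x := by
  rcases hx.eq_or_lt with rfl | hx
  · simp
  have h := Real.log_le_sub_one_of_pos (div_pos hx ht)
  rw [Real.log_div hx.ne' ht.ne'] at h
  have h2 := mul_le_mul_of_nonneg_left h hx.le
  have h3 : x * (x / t - 1) = x ^ 2 / t - x := by ring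
  rw [Real.negMulLog]
  nlinarith

theorem negMulLog_le_tangent {x m : ℝ} (hx : 0 < x) (hm : 0 < m) :
    Real.negMulLog x ≤ x * Real.log m + 1 / m - x := by
  have h := Real.log_le_sub_one_of_pos (one_div_pos.mpr (mul_pos hm hx))
  rw [Real.log_div one_ne_zero (mul_pos hm hx).ne', Real.log_one, Real.log_mul hm.ne' hx.ne'] at h
  have h2 := mul_le_mul_of_nonneg_left h hx.le
  have h3 : x * (1 / (m * x) - 1) = 1 / m - x := by field_simp
  rw [Real.negMulLog]
  nlinarith

theorem Matrix.IsHermitian.le_sum_negMulLog_eigenvalues [DecidableEq n] {A : Matrix n n ℂ}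
    (hA : A.IsHermitian) (h0 : ∀ k, 0 ≤ hA.eigenvalues k) {t : ℝ} (ht : 0 < t) :
    (1 - Real.log t) * A.trace.re - (A * A).trace.re / t ≤
      ∑ k, Real.negMulLog (hA.eigenvalues k) := by
  have h1 : A.trace.re = ∑ k, hA.eigenvalues k := by
    rw [hA.trace_eq_sum_eigenvalues]; simp
  rw [h1, hA.trace_mul_self_eq_sum_eigenvalues, Complex.ofReal_re, Finset.mul_sum,
    Finset.sum_div, ← Finset.sum_sub_distrib]
  exact Finset.sum_le_sum fun k _ => mul_tangent_le_negMulLog (h0 k) ht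

theorem Matrix.IsHermitian.sum_negMulLog_eigenvalues_le [DecidableEq n] {A : Matrix n n ℂ}
    (hA : A.IsHermitian) (h0 : ∀ k, 0 ≤ hA.eigenvalues k) {m : ℕ} (hm : 0 < m)
    (hr : A.rank ≤ m) :
    ∑ k, Real.negMulLog (hA.eigenvalues k) ≤ A.trace.re * Real.log m + 1 - A.trace.re := by
  have hm' : (0 : ℝ) < m := by exact_mod_cast hm
  have h1 : A.trace.re = ∑ k, hA.eigenvalues k := by
    rw [hA.trace_eq_sum_eigenvalues]; simp
  have h2 : ∀ k, Real.negMulLog (hA.eigenvalues k) ≤ hA.eigenvalues k * Real.log m +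
      (if hA.eigenvalues k ≠ 0 then 1 / (m : ℝ) else 0) - hA.eigenvalues k := by
    intro k
    by_cases hk : hA.eigenvalues k = 0
    · simp [hk]
    · rw [if_pos hk]
      exact negMulLog_le_tangent (lt_of_le_of_ne (h0 k) (Ne.symm hk)) hm'
  refine (Finset.sum_le_sum fun k _ => h2 k).trans ?_
  rw [Finset.sum_sub_distrib, Finset.sum_add_distrib, ← Finset.sum_mul, ← h1,
    ← Finset.sum_filter, Finset.sum_const, nsmul_eq_mul, ← Fintype.card_subtype,
    ← hA.rank_eq_card_non_zero_eigs]
  have h3 : (A.rank : ℝ) * (1 / m) ≤ 1 := by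
    rw [mul_one_div, div_le_one hm']
    exact_mod_cast hr
  linarith

end Entropy

section ReducedDensity

variable {L Q : Type} [Fintype L] [Fintype Q]

/-- The amplitudes of a state, as a matrix with rows labelled by the sites in `A` and columns by
the other sites. -/
def amplitudeMatrix (ψ : (L → Q) → ℂ) (A : Finset L) :
    Matrix ({l // l ∈ A} → Q) ({l // ¬ l ∈ A} → Q) ℂ :=
  Matrix.of fun a b =>
    ψ ((Equiv.piEquivPiSubtypeProd (fun l => l ∈ A) fun _ => Q).symm (a, b))

/-- The Schmidt rank of a state with respect to the sites in `A`. -/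
def schmidtRank (ψ : (L → Q) → ℂ) (A : Finset L) : ℕ := (amplitudeMatrix ψ A).rank

/-- The trace of the reduced density matrix. -/
def reducedTrace (ψ : (L → Q) → ℂ) (A : Finset L) : ℂ := (reducedDensity ψ A).trace

/-- The purity of the reduced density matrix. -/
def purity (ψ : (L → Q) → ℂ) (A : Finset L) : ℂ :=
  (reducedDensity ψ A * reducedDensity ψ A).trace

theorem reducedDensity_eq_mul (ψ : (L → Q) → ℂ) (A : Finset L) :
    reducedDensity ψ A = amplitudeMatrix ψ A * (amplitudeMatrix ψ A)ᴴ := by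
  ext a a'
  simp [reducedDensity, amplitudeMatrix, Matrix.mul_apply]

theorem reducedDensity_eigenvalues_nonneg (ψ : (L → Q) → ℂ) (A : Finset L) (k) :
    0 ≤ (reducedDensity_isHermitian ψ A).eigenvalues k := by
  have h : (reducedDensity ψ A).PosSemidef := by
    rw [reducedDensity_eq_mul]
    exact Matrix.posSemidef_self_mul_conjTranspose _
  exact h.eigenvalues_nonneg k

theorem le_entanglementEntropy (ψ : (L → Q) → ℂ) (A : Finset L) {t : ℝ} (ht : 0 < t) :
    (1 - Real.log t) * (reducedTrace ψ A).re - (purity ψ A).re / t ≤ entanglementEntropy ψ A :=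
  (reducedDensity_isHermitian ψ A).le_sum_negMulLog_eigenvalues
    (reducedDensity_eigenvalues_nonneg ψ A) ht

theorem entanglementEntropy_le (ψ : (L → Q) → ℂ) (A : Finset L) {m : ℕ} (hm : 0 < m)
    (hr : schmidtRank ψ A ≤ m) :
    entanglementEntropy ψ A ≤ (reducedTrace ψ A).re * Real.log m + 1 - (reducedTrace ψ A).re := by
  refine (reducedDensity_isHermitian ψ A).sum_negMulLog_eigenvalues_le
    (reducedDensity_eigenvalues_nonneg ψ A) hm (le_trans ?_ hr)
  rw [reducedDensity_eq_mul]
  exact Matrix.rank_mul_le_left _ _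

/-- The trace of the reduced density matrix is the squared norm of the state. -/
theorem reducedTrace_eq_sum [inst : DecidableEq L] (ψ : (L → Q) → ℂ) (A : Finset L) :
    reducedTrace ψ A = ∑ x, ψ x * star (ψ x) := by
  obtain rfl : inst = fun a b => Classical.propDecidable _ := Subsingleton.elim _ _
  rw [← (Equiv.piEquivPiSubtypeProd (fun l => l ∈ A) fun _ => Q).symm.sum_comp,
    Fintype.sum_prod_type]
  simp [reducedTrace, Matrix.trace, reducedDensity]

theorem schmidtRank_le {K : Type*} [Fintype K] {ψ : (L → Q) → ℂ} {A : Finset L}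
    (f : ({l // l ∈ A} → Q) → K → ℂ) (g : K → ({l // ¬ l ∈ A} → Q) → ℂ)
    (h : ∀ x, ψ x = ∑ k, f (fun l => x l.1) k * g k fun l => x l.1) :
    schmidtRank ψ A ≤ Fintype.card K := by
  have hmul : amplitudeMatrix ψ A = Matrix.of f * Matrix.of g := by
    ext a b
    obtain ⟨x, hx⟩ := (Equiv.piEquivPiSubtypeProd (fun l => l ∈ A) fun _ => Q).surjective (a, b)
    rw [amplitudeMatrix, Matrix.of_apply, ← hx, Equiv.symm_apply_apply, h, Matrix.mul_apply]
    simp only [Equiv.piEquivPiSubtypeProd, Equiv.coe_fn_mk, Prod.mk.injEq] at hx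
    rw [← hx.1, ← hx.2]
    rfl
  rw [schmidtRank, hmul]
  exact (Matrix.rank_mul_le_left _ _).trans (Matrix.rank_le_card_width _)

/-- Merge `x` on `A` with `y` outside `A`. -/
def merge (A : Finset L) (x y : L → Q) : L → Q := fun l => if l ∈ A then x l else y l

/-- The purity as a sum over two copies of the system, with the sites in `A` exchanged between the
copies of the conjugate state. -/
theorem purity_eq_sum [inst : DecidableEq L] (ψ : (L → Q) → ℂ) (A : Finset L) :
    purity ψ A = ∑ x, ∑ x', ψ x * ψ x' *
      (star (ψ (merge A x' x)) * star (ψ (merge A x x'))) := by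
  obtain rfl : inst = fun a b => Classical.propDecidable _ := Subsingleton.elim _ _
  have key : ∀ a a' b b',
      merge A ((Equiv.piEquivPiSubtypeProd (fun l => l ∈ A) fun _ => Q).symm (a, b))
        ((Equiv.piEquivPiSubtypeProd (fun l => l ∈ A) fun _ => Q).symm (a', b')) =
      (Equiv.piEquivPiSubtypeProd (fun l => l ∈ A) fun _ => Q).symm (a, b') := by
    intro a a' b b'
    funext l
    by_cases h : l ∈ A <;> simp [merge, Equiv.piEquivPiSubtypeProd, h]
  rw [← (Equiv.piEquivPiSubtypeProd (fun l => l ∈ A) fun _ => Q).symm.sum_comp,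
    Fintype.sum_prod_type]
  simp_rw [← (Equiv.piEquivPiSubtypeProd (fun l => l ∈ A) fun _ => Q).symm.sum_comp
    (fun x' => _ * ψ x' * _), Fintype.sum_prod_type, key]
  simp only [purity, Matrix.trace, reducedDensity, Matrix.diag, Matrix.mul_apply, Matrix.of_apply,
    Finset.sum_mul_sum]
  refine Finset.sum_congr rfl fun a _ => ?_
  rw [Finset.sum_comm]
  refine Finset.sum_congr rfl fun b _ => Finset.sum_congr rfl fun a' _ =>
    Finset.sum_congr rfl fun b' _ => ?_
  ring

end ReducedDensity

/-! ### The Clifford group is a unitary two-design -/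

section Clifford

variable {ι : Type} [Fintype ι] [DecidableEq ι]

theorem sgn_mul_self (s : ZMod 2) : sgn s * sgn s = 1 := by
  unfold sgn; split_ifs <;> norm_num

theorem star_sgn (s : ZMod 2) : star (sgn s) = sgn s := by
  unfold sgn; split_ifs <;> simp

theorem sum_sgn_dotProduct (a : Bits ι) :
    ∑ y : Bits ι, sgn (a ⬝ᵥ y) = if a = 0 then (Fintype.card (Bits ι) : ℂ) else 0 := by
  split_ifs with h
  · simp [h, sgn]
  · obtain ⟨q, hq⟩ := Function.ne_iff.mp h
    have h1 : a q = 1 := by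
      have : ∀ s : ZMod 2, s ≠ 0 → s = 1 := by decide
      exact this _ hq
    have h2 := Equiv.sum_comp (Equiv.addRight (Pi.single q 1 : Bits ι)) fun y => sgn (a ⬝ᵥ y)
    simp only [Equiv.coe_addRight, dotProduct_add, dotProduct_single, h1, mul_one, sgn_add,
      ← Finset.sum_mul] at h2
    have h3 : sgn 1 = -1 := by simp [sgn]
    rw [h3] at h2
    linear_combination -h2 / 2

/-- Conjugation by the matrix maps Pauli strings to Pauli strings up to powers of `i`. -/
def PermutesPaulis (M : Matrix (Bits ι) (Bits ι) ℂ) : Prop :=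
  ∀ a b, ∃ (k : ℕ) (a' b' : Bits ι), M * pauli a b = (Complex.I ^ k • pauli a' b') * M

theorem mem_cliffordGroup_of_permutesPaulis (U : Matrix.unitaryGroup (Bits ι) ℂ)
    (h : PermutesPaulis (U : Matrix (Bits ι) (Bits ι) ℂ)) : U ∈ cliffordGroup ι := by
  have := finite_pauliGroup ι
  rw [cliffordGroup, Subgroup.mem_normalizer_iff_map_conj_eq]
  refine Subgroup.eq_of_le_of_card_ge ?_ (Subgroup.card_map_of_injective (MulAut.conj U).injective).ge
  rintro _ ⟨V, ⟨k, a, b, hV⟩, rfl⟩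
  obtain ⟨l, a', b', hU⟩ := h a b
  refine ⟨k + l, a', b', ?_⟩
  have h1 : (U : Matrix (Bits ι) (Bits ι) ℂ) * ((U⁻¹ : Matrix.unitaryGroup (Bits ι) ℂ) :
        Matrix (Bits ι) (Bits ι) ℂ) = 1 := by
    rw [← Matrix.UnitaryGroup.mul_val, mul_inv_cancel, Matrix.UnitaryGroup.one_val]
  simp only [MonoidHom.coe_coe, MulAut.conj_apply, Matrix.UnitaryGroup.mul_val]
  rw [hV, Matrix.mul_smul, hU, Matrix.smul_mul, Matrix.mul_assoc, h1, mul_one, smul_smul, pow_add]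

theorem exists_smul_eq_specialClifford {M : Matrix (Bits ι) (Bits ι) ℂ}
    (hM : M ∈ Matrix.unitaryGroup (Bits ι) ℂ) (h : PermutesPaulis M) :
    ∃ (c : specialCliffordGroup ι) (z : ℂ), z ≠ 0 ∧ (c.1 : Matrix (Bits ι) (Bits ι) ℂ) = z • M := by
  have hcard : 0 < Fintype.card (Bits ι) := Fintype.card_pos
  have hdet : star M.det * M.det = 1 := by
    rw [← Matrix.det_conjTranspose, ← Matrix.det_mul]
    rw [Matrix.mem_unitaryGroup_iff'] at hM
    rw [← Matrix.star_eq_conjTranspose, hM, Matrix.det_one]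
  obtain ⟨z, hz⟩ := IsAlgClosed.exists_pow_nat_eq (star M.det) hcard
  have hnorm : ‖z‖ = 1 := by
    have h1 : ‖M.det‖ = 1 := by
      have := congrArg norm hdet
      rw [norm_mul, norm_star, norm_one] at this
      nlinarith [norm_nonneg M.det]
    have h2 := congrArg norm hz
    rw [norm_pow, norm_star, h1] at h2
    exact (pow_eq_one_iff_of_nonneg (norm_nonneg z) hcard.ne').mp h2
  have hzz : star z * z = 1 := by
    rw [Complex.star_def, ← Complex.normSq_eq_conj_mul_self, Complex.normSq_eq_norm_sq, hnorm]
    simp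
  have hU : z • M ∈ Matrix.unitaryGroup (Bits ι) ℂ := by
    rw [Matrix.mem_unitaryGroup_iff'] at hM ⊢
    rw [star_smul, Matrix.smul_mul, Matrix.mul_smul, hM, smul_smul, hzz, one_smul]
  refine ⟨⟨⟨z • M, hU⟩, ?_, ?_⟩, z, ?_, rfl⟩
  · refine mem_cliffordGroup_of_permutesPaulis _ fun a b => ?_
    obtain ⟨k, a', b', hk⟩ := h a b
    exact ⟨k, a', b', by simp only [Matrix.smul_mul, hk, Matrix.mul_smul]⟩
  · change (z • M).det = 1
    rw [Matrix.det_smul, hz, hdet]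
  · rintro rfl
    simp at hzz

theorem permutesPaulis_pauli (a b : Bits ι) : PermutesPaulis (pauli a b) := by
  intro a' b'
  refine ⟨2 * (b ⬝ᵥ a').val + 2 * (b' ⬝ᵥ a).val, a', b', ?_⟩
  rw [pow_add, ← sgn_eq_pow, ← sgn_eq_pow, Matrix.smul_mul, pauli_mul, pauli_mul, smul_smul,
    add_comm a, add_comm b, mul_assoc, sgn_mul_self, mul_one]

/-- The phase gate `|x⟩ ↦ i^(b ⬝ x) |x⟩`, with `b ⬝ x` taken in `{0, 1}`. -/
def phaseGate (b : Bits ι) : Matrix (Bits ι) (Bits ι) ℂ :=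
  Matrix.diagonal fun x => Complex.I ^ (b ⬝ᵥ x).val

theorem phaseGate_mem (b : Bits ι) : phaseGate b ∈ Matrix.unitaryGroup (Bits ι) ℂ := by
  rw [Matrix.mem_unitaryGroup_iff', phaseGate, Matrix.star_eq_conjTranspose,
    Matrix.diagonal_conjTranspose, Matrix.diagonal_mul_diagonal, ← Matrix.diagonal_one]
  congr 1
  funext x
  simp only [Pi.star_apply, star_pow, Complex.star_def, Complex.conj_I, ← mul_pow]
  simp

theorem permutesPaulis_phaseGate (b : Bits ι) : PermutesPaulis (phaseGate b) := by
  intro a c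
  have h2 : ∀ s : ZMod 2, s = 0 ∨ s = 1 := by decide
  refine ⟨(b ⬝ᵥ a).val, a, c + (b ⬝ᵥ a) • b, ?_⟩
  ext x y
  rw [phaseGate, Matrix.diagonal_mul, Matrix.mul_diagonal, Matrix.smul_apply]
  simp only [pauli, Matrix.of_apply, smul_eq_mul]
  split_ifs with h
  · rw [h, dotProduct_add, add_dotProduct, smul_dotProduct, sgn_add]
    rcases h2 (b ⬝ᵥ a) with ha | ha <;> rcases h2 (b ⬝ᵥ y) with hy | hy <;>
      simp [ha, hy, sgn, ZMod.val_one]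
    have h11 : (1 : ZMod 2) + 1 = 0 := rfl
    simp [h11]
    split_ifs <;> simp
  · simp

/-- The Hadamard gate on all qubits. -/
def hadamardGate (ι : Type) [Fintype ι] [DecidableEq ι] : Matrix (Bits ι) (Bits ι) ℂ :=
  Matrix.of fun x y => ((1 / √(Fintype.card (Bits ι)) : ℝ) : ℂ) * sgn (x ⬝ᵥ y)

theorem hadamard_mem : hadamardGate ι ∈ Matrix.unitaryGroup (Bits ι) ℂ := by
  rw [Matrix.mem_unitaryGroup_iff']
  ext x y
  have hcard : (0 : ℝ) < Fintype.card (Bits ι) := by exact_mod_cast Fintype.card_pos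
  have hr : ((1 / √(Fintype.card (Bits ι)) : ℝ) : ℂ) * ((1 / √(Fintype.card (Bits ι)) : ℝ) : ℂ) *
      (Fintype.card (Bits ι) : ℂ) = 1 := by
    rw [← Complex.ofReal_natCast, ← Complex.ofReal_mul, ← Complex.ofReal_mul]
    rw [div_mul_div_comm, Real.mul_self_sqrt hcard.le]
    field_simp
    simp
  have h : ∀ z : Bits ι, star (hadamardGate ι z x) * hadamardGate ι z y =
      ((1 / √(Fintype.card (Bits ι)) : ℝ) : ℂ) * ((1 / √(Fintype.card (Bits ι)) : ℝ) : ℂ) *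
        sgn ((x + y) ⬝ᵥ z) := by
    intro z
    simp only [hadamardGate, Matrix.of_apply, star_mul', star_sgn]
    rw [add_dotProduct, sgn_add, dotProduct_comm x, dotProduct_comm y, Complex.star_def,
      Complex.conj_ofReal]
    ring
  simp only [Matrix.mul_apply, Matrix.star_apply, h, ← Finset.mul_sum, sum_sgn_dotProduct,
    Matrix.one_apply]
  have hxy : x + y = 0 ↔ x = y := by
    rw [add_eq_zero_iff_eq_neg, show -y = y from funext fun q => ZMod.neg_eq_self_mod_two _]
  simp only [hxy]
  split_ifs
  · exact hr
  · simp

theorem permutesPaulis_hadamard : PermutesPaulis (hadamardGate ι) := by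
  intro a b
  refine ⟨2 * (a ⬝ᵥ b).val, b, a, ?_⟩
  ext x y
  rw [← sgn_eq_pow, Matrix.mul_apply, Finset.sum_eq_single (y + a), Matrix.mul_apply,
    Finset.sum_eq_single (x + b)]
  · have h1 : x = x + b + b := by rw [add_assoc, bits_add_self, add_zero]
    simp only [hadamardGate, pauli, Matrix.of_apply, Matrix.smul_apply, smul_eq_mul, if_true]
    rw [if_pos h1]
    simp only [dotProduct_add, add_dotProduct, sgn_add]
    rw [dotProduct_comm a x]
    linear_combination (-(((1 / √(Fintype.card (Bits ι)) : ℝ) : ℂ) * sgn (x ⬝ᵥ y) * sgn (x ⬝ᵥ a) *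
      sgn (b ⬝ᵥ y))) * sgn_mul_self (a ⬝ᵥ b)
  · intro z _ hz
    have : ¬ x = z + b := fun e => hz (by rw [e, add_assoc, bits_add_self, add_zero])
    simp [pauli, this]
  · simp
  · intro z _ hz
    simp [pauli, hz]
  · simp

theorem bits_eq_iff_dotProduct {x y : Bits ι} : x = y ↔ ∀ b : Bits ι, b ⬝ᵥ x = b ⬝ᵥ y :=
  ⟨fun h b => by rw [h], fun h => funext fun q => by simpa using h (Pi.single q 1)⟩

/-- A vector space over the field of two elements is not the union of two proper subspaces. -/
theorem eq_or_eq_of_forall_dotProduct {x x' y : Bits ι}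
    (h : ∀ b : Bits ι, b ⬝ᵥ y = b ⬝ᵥ x ∨ b ⬝ᵥ y = b ⬝ᵥ x') : y = x ∨ y = x' := by
  by_contra! hne
  obtain ⟨b, hb⟩ := not_forall.mp (mt bits_eq_iff_dotProduct.mpr hne.1)
  obtain ⟨b', hb'⟩ := not_forall.mp (mt bits_eq_iff_dotProduct.mpr hne.2)
  have h1 := (h b).resolve_left hb
  have h2 := (h b').resolve_right hb'
  rcases h (b + b') with h3 | h3
  · rw [add_dotProduct, add_dotProduct, h2] at h3
    exact hb (add_right_cancel h3)
  · rw [add_dotProduct, add_dotProduct, h1] at h3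
    exact hb' (add_left_cancel h3)

theorem exists_dotProduct_eq_one {d e : Bits ι} (hd : d ≠ 0) (he : e ≠ 0) :
    ∃ c : Bits ι, d ⬝ᵥ c = 1 ∧ e ⬝ᵥ c = 1 := by
  have h2 : ∀ s : ZMod 2, s ≠ 0 → s = 1 := by decide
  by_contra! h
  have h3 : (0 : Bits ι) = d ∨ (0 : Bits ι) = e := by
    refine eq_or_eq_of_forall_dotProduct fun b => ?_
    rw [dotProduct_zero, dotProduct_comm b, dotProduct_comm b]
    by_contra! hb
    exact h b (h2 _ hb.1.symm) (h2 _ hb.2.symm)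
  rcases h3 with h3 | h3
  · exact hd h3.symm
  · exact he h3.symm

theorem I_pow_val_add_val {s t u w : ZMod 2}
    (h : Complex.I ^ (s.val + t.val) = Complex.I ^ (u.val + w.val)) :
    s + t = u + w ∧ (u = s ∨ u = t) := by
  have h2 : ∀ s : ZMod 2, s = 0 ∨ s = 1 := by decide
  have h3 : (1 : ℂ) ≠ Complex.I := fun e => by simpa using congrArg Complex.im e
  have h4 : (-1 : ℂ) ≠ Complex.I := fun e => by simpa using congrArg Complex.im e
  have h5 : (1 : ℂ) ≠ -1 := by norm_num
  rcases h2 s with rfl | rfl <;> rcases h2 t with rfl | rfl <;> rcases h2 u with rfl | rfl <;>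
    rcases h2 w with rfl | rfl <;>
    simp [ZMod.val_one, h3, h4, h5, h3.symm, h4.symm, h5.symm] at h ⊢

end Clifford

section TwoDesign

variable {ι : Type} [Fintype ι] [DecidableEq ι]

/-- The pairs are equal, up to an exchange if `s` is true. -/
def PairEq {α : Type*} (s : Bool) (x x' y y' : α) : Prop :=
  if s then x = y' ∧ x' = y else x = y ∧ x' = y'

theorem kronecker_commute_of_permutesPaulis {X : Matrix (Bits ι × Bits ι) (Bits ι × Bits ι) ℂ}
    (hX : ∀ c : specialCliffordGroup ι, (c.1.1 ⊗ₖ c.1.1) * X = X * (c.1.1 ⊗ₖ c.1.1))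
    {M : Matrix (Bits ι) (Bits ι) ℂ} (hM : M ∈ Matrix.unitaryGroup (Bits ι) ℂ)
    (h : PermutesPaulis M) : (M ⊗ₖ M) * X = X * (M ⊗ₖ M) := by
  obtain ⟨c, z, hz, hc⟩ := exists_smul_eq_specialClifford hM h
  have h1 := hX c
  simp only [hc, smul_kronecker, kronecker_smul, Matrix.smul_mul, Matrix.mul_smul] at h1
  exact smul_right_injective _ hz (smul_right_injective _ hz h1)

theorem eq_of_sgn_mul {f G : Bits ι → ℂ} (h0 : G 0 = 0)
    (h : ∀ d e : Bits ι, f e - f d + sgn (d ⬝ᵥ e) * (G e - G d) = 0) {d e : Bits ι} (hd : d ≠ 0)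
    (he : e ≠ 0) : f d = f e := by
  have h1 : ∀ e, f e + G e = f 0 := by
    intro e
    have := h 0 e
    rw [zero_dotProduct, h0, sgn, if_pos rfl] at this
    linear_combination this
  have h2 : ∀ d e : Bits ι, d ⬝ᵥ e = 1 → f d = f e := by
    intro d e hde
    have := h d e
    rw [hde, sgn, if_neg one_ne_zero] at this
    linear_combination (-1 / 2 : ℂ) * this + (1 / 2 : ℂ) * h1 d - (1 / 2 : ℂ) * h1 e
  obtain ⟨c, hc, hc'⟩ := exists_dotProduct_eq_one hd he
  rw [h2 d c hc, h2 e c hc']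

/-- A matrix that commutes with the tensor squares of all Clifford unitaries is a combination of
the identity and the exchange of the tensor factors. -/
theorem exists_eq_of_commute_clifford {X : Matrix (Bits ι × Bits ι) (Bits ι × Bits ι) ℂ}
    (hX : ∀ c : specialCliffordGroup ι, (c.1.1 ⊗ₖ c.1.1) * X = X * (c.1.1 ⊗ₖ c.1.1)) :
    ∃ w : Bool → ℂ, ∀ x x' y y', X (x, x') (y, y') =
      ∑ s, w s * if PairEq s x x' y y' then 1 else 0 := by
  have hsupp : ∀ x x' y y', X (x, x') (y, y') ≠ 0 → (y = x ∧ y' = x') ∨ (y = x' ∧ y' = x) := by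
    intro x x' y y' hne
    have h1 : ∀ b : Bits ι, b ⬝ᵥ x + b ⬝ᵥ x' = b ⬝ᵥ y + b ⬝ᵥ y' ∧
        (b ⬝ᵥ y = b ⬝ᵥ x ∨ b ⬝ᵥ y = b ⬝ᵥ x') := by
      intro b
      apply I_pow_val_add_val
      have := congrFun (congrFun (kronecker_commute_of_permutesPaulis hX (phaseGate_mem b)
        (permutesPaulis_phaseGate b)) (x, x')) (y, y')
      rw [phaseGate, diagonal_kronecker_diagonal, Matrix.diagonal_mul, Matrix.mul_diagonal,
        mul_comm] at this
      have := mul_left_cancel₀ hne this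
      simpa [pow_add] using this
    have hsum : x + x' = y + y' := bits_eq_iff_dotProduct.mpr fun b => by
      rw [dotProduct_add, dotProduct_add, (h1 b).1]
    rcases eq_or_eq_of_forall_dotProduct fun b => (h1 b).2 with h | h
    · left
      rw [h] at hsum
      exact ⟨h, (add_left_cancel hsum).symm⟩
    · right
      rw [h, add_comm x] at hsum
      exact ⟨h, (add_left_cancel hsum).symm⟩
  have htrans : ∀ a x x' y y', X (x + a, x' + a) (y + a, y' + a) = X (x, x') (y, y') := by
    intro a x x' y y'
    have := congrFun (congrFun (kronecker_commute_of_permutesPaulis hX (pauli_unitary a 0)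
        (permutesPaulis_pauli a 0)) (x + a, x' + a)) (y, y')
    rw [Matrix.mul_apply, Finset.sum_eq_single (x, x'), Matrix.mul_apply,
      Finset.sum_eq_single (y + a, y' + a)] at this
    · simpa [pauli, sgn] using this.symm
    · rintro ⟨z, z'⟩ _ hz
      have : ¬ (z = y + a ∧ z' = y' + a) := fun e => hz (Prod.ext e.1 e.2)
      rw [not_and_or] at this
      rcases this with h | h <;> simp [pauli, h]
    · simp
    · rintro ⟨z, z'⟩ _ hz
      have : ¬ (x = z ∧ x' = z') := fun e => hz (Prod.ext e.1.symm e.2.symm)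
      rw [not_and_or] at this
      rcases this with h | h <;> simp [pauli, h]
    · simp
  let f : Bits ι → ℂ := fun d => X (0, d) (0, d)
  let G : Bits ι → ℂ := fun d => if d = 0 then 0 else X (0, d) (d, 0)
  have hXfG : ∀ x x' y y', X (x, x') (y, y') = (if y = x ∧ y' = x' then f (x + x') else 0) +
      if y = x' ∧ y' = x then G (x + x') else 0 := by
    intro x x' y y'
    have hxx : ∀ x x' : Bits ι, x + x' = 0 ↔ x' = x := fun x x' => by
      rw [add_eq_zero_iff_eq_neg, show -x' = x' from funext fun q => ZMod.neg_eq_self_mod_two _,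
        eq_comm]
    by_cases hne : X (x, x') (y, y') = 0
    · by_cases h1 : y = x ∧ y' = x'
      · have h3 := htrans x x x' y y'
        rw [hne, h1.1, h1.2, bits_add_self, add_comm x' x] at h3
        have h4 : f (x + x') = 0 := h3
        rw [hne, h4]
        by_cases h2 : y = x' ∧ y' = x
        · have : G (x + x') = 0 := if_pos ((hxx _ _).mpr (by rw [← h1.2, h2.2]))
          simp [this]
        · simp [h2]
      · by_cases h2 : y = x' ∧ y' = x
        · have h3 := htrans x x x' y y'
          rw [hne, h2.1, h2.2, bits_add_self, add_comm x' x] at h3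
          have h4 : G (x + x') = 0 := by
            by_cases h5 : x + x' = 0
            · exact if_pos h5
            · exact (if_neg h5).trans h3
          simp [hne, h1, h4]
        · simp [hne, h1, h2]
    · by_cases hx : x' = x
      · have h0 : G (x + x') = 0 := if_pos ((hxx _ _).mpr hx)
        have h1 : y = x ∧ y' = x' := by
          rcases hsupp _ _ _ _ hne with h | h
          · exact h
          · rw [hx] at h; rw [hx]; exact h
        have h3 := htrans x x x' y y'
        rw [h1.1, h1.2, bits_add_self, add_comm x' x] at h3
        simp only [h1, and_self, if_true, h0, ite_self, add_zero]
        exact h3.symm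
      · rcases hsupp _ _ _ _ hne with h | h
        · have h2 : ¬ (y = x' ∧ y' = x) := fun e => hx (by rw [← e.1, h.1])
          have h3 := htrans x x x' y y'
          rw [h.1, h.2, bits_add_self, add_comm x' x] at h3
          rw [if_pos h, if_neg h2, add_zero, h.1, h.2]
          exact h3.symm
        · have h2 : ¬ (y = x ∧ y' = x') := fun e => hx (by rw [← e.1, h.1])
          have h3 := htrans x x x' y y'
          rw [h.1, h.2, bits_add_self, add_comm x' x] at h3
          rw [if_neg h2, if_pos h, zero_add, h.1, h.2]
          have : G (x + x') = X (0, x + x') (x + x', 0) := if_neg (by rw [hxx]; exact hx)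
          rw [this]
          exact h3.symm
  have hhad : ∀ d e : Bits ι, f e - f d + sgn (d ⬝ᵥ e) * (G e - G d) = 0 := by
    intro d e
    have h := congrFun (congrFun (kronecker_commute_of_permutesPaulis hX hadamard_mem
        permutesPaulis_hadamard) (0, d)) (0, e)
    have hr : ((1 / √(Fintype.card (Bits ι)) : ℝ) : ℂ) ≠ 0 := by
      have : (0 : ℝ) < √(Fintype.card (Bits ι)) :=
        Real.sqrt_pos.mpr (by exact_mod_cast Fintype.card_pos)
      exact_mod_cast (one_div_pos.mpr this).ne'
    have hl : ((hadamardGate ι ⊗ₖ hadamardGate ι) * X) (0, d) (0, e) =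
        ((1 / √(Fintype.card (Bits ι)) : ℝ) : ℂ) * ((1 / √(Fintype.card (Bits ι)) : ℝ) : ℂ) *
          (sgn (d ⬝ᵥ e) * f e + G e) := by
      rw [Matrix.mul_apply, Fintype.sum_prod_type]
      simp only [hXfG, mul_add, Finset.sum_add_distrib]
      congr 1
      · rw [Finset.sum_eq_single 0, Finset.sum_eq_single e]
        · simp [hadamardGate, sgn]
        · intro z _ hz; simp [hz.symm]
        · simp
        · intro z _ hz; simp [hz.symm]
        · simp
      · rw [Finset.sum_eq_single e, Finset.sum_eq_single 0]
        · simp [hadamardGate, sgn]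
        · intro z _ hz; simp [hz.symm]
        · simp
        · intro z _ hz; simp [hz.symm]
        · simp
    have hrr : (X * (hadamardGate ι ⊗ₖ hadamardGate ι)) (0, d) (0, e) =
        ((1 / √(Fintype.card (Bits ι)) : ℝ) : ℂ) * ((1 / √(Fintype.card (Bits ι)) : ℝ) : ℂ) *
          (sgn (d ⬝ᵥ e) * f d + G d) := by
      rw [Matrix.mul_apply, Fintype.sum_prod_type]
      simp only [hXfG, add_mul, mul_add, Finset.sum_add_distrib]
      congr 1
      · rw [Finset.sum_eq_single 0, Finset.sum_eq_single d]
        · simp [hadamardGate, sgn]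
          split_ifs <;> ring
        · intro z _ hz; simp [hz]
        · simp
        · intro z _ hz; simp [hz]
        · simp
      · rw [Finset.sum_eq_single d, Finset.sum_eq_single 0]
        · simp [hadamardGate, sgn]
          ring
        · intro z _ hz; simp [hz]
        · simp
        · intro z _ hz; simp [hz]
        · simp
    rw [hl, hrr] at h
    have h2 := mul_left_cancel₀ (mul_ne_zero hr hr) h
    linear_combination sgn (d ⬝ᵥ e) * h2 - (f e - f d) * sgn_mul_self (d ⬝ᵥ e)
  have hG0 : G 0 = 0 := if_pos rfl
  have hfG : ∀ e, f e + G e = f 0 := by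
    intro e
    have := hhad 0 e
    rw [zero_dotProduct, hG0, sgn, if_pos rfl] at this
    linear_combination this
  obtain ⟨α, hα⟩ : ∃ α, ∀ d, d ≠ 0 → f d = α := by
    by_cases h : ∃ d : Bits ι, d ≠ 0
    · obtain ⟨d, hd⟩ := h
      exact ⟨f d, fun e he => eq_of_sgn_mul hG0 hhad he hd⟩
    · exact ⟨0, fun d hd => absurd ⟨d, hd⟩ h⟩
  refine ⟨fun s => if s then f 0 - α else α, fun x x' y y' => ?_⟩
  rw [hXfG, Fintype.sum_bool]
  have e1 : PairEq true x x' y y' ↔ (y = x' ∧ y' = x) := by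
    simp only [PairEq, if_true]; tauto
  have e2 : PairEq false x x' y y' ↔ (y = x ∧ y' = x') := by
    simp [PairEq, eq_comm]
  simp only [e1, e2, if_true, Bool.false_eq_true, if_false]
  by_cases hx : x = x'
  · have h0 : x + x' = 0 := by rw [hx, bits_add_self]
    rw [h0, hG0, hx]
    by_cases h : y = x' ∧ y' = x' <;> simp [h]
  · have h0 : x + x' ≠ 0 := fun h => hx (by
      rw [add_eq_zero_iff_eq_neg] at h
      rw [h]; exact funext fun q => ZMod.neg_eq_self_mod_two _)
    have := hfG (x + x')
    rw [hα _ h0] at this ⊢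
    rw [← this]
    split_ifs <;> simp [add_comm]

end TwoDesign

section Moments

variable {ι : Type} [Fintype ι] [DecidableEq ι]

/-- The Weingarten function of two copies of a `D`-dimensional system. -/
def weingarten (D : ℂ) (s t : Bool) : ℂ :=
  if s = t then 1 / (D ^ 2 - 1) else -1 / (D * (D ^ 2 - 1))

theorem kronecker_conjTranspose_mul {M : Matrix (Bits ι) (Bits ι) ℂ}
    (hM : M ∈ Matrix.unitaryGroup (Bits ι) ℂ) : (M ⊗ₖ M)ᴴ * (M ⊗ₖ M) = 1 := by
  rw [Matrix.mem_unitaryGroup_iff', Matrix.star_eq_conjTranspose] at hM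
  rw [conjTranspose_kronecker, ← mul_kronecker_mul, hM, one_kronecker_one]

theorem kronecker_mul_conjTranspose {M : Matrix (Bits ι) (Bits ι) ℂ}
    (hM : M ∈ Matrix.unitaryGroup (Bits ι) ℂ) : (M ⊗ₖ M) * (M ⊗ₖ M)ᴴ = 1 := by
  rw [Matrix.mem_unitaryGroup_iff, Matrix.star_eq_conjTranspose] at hM
  rw [conjTranspose_kronecker, ← mul_kronecker_mul, hM, one_kronecker_one]

/-- The twirl of a matrix over the tensor squares of the Clifford group. -/
def cliffordTwirl (E : Matrix (Bits ι × Bits ι) (Bits ι × Bits ι) ℂ) :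
    Matrix (Bits ι × Bits ι) (Bits ι × Bits ι) ℂ :=
  ∑ c : specialCliffordGroup ι, (c.1.1 ⊗ₖ c.1.1) * E * (c.1.1 ⊗ₖ c.1.1)ᴴ

theorem kronecker_mul_cliffordTwirl (E : Matrix (Bits ι × Bits ι) (Bits ι × Bits ι) ℂ)
    (g : specialCliffordGroup ι) :
    (g.1.1 ⊗ₖ g.1.1) * cliffordTwirl E = cliffordTwirl E * (g.1.1 ⊗ₖ g.1.1) := by
  have hK : ∀ c : specialCliffordGroup ι,
      (((g * c).1.1 ⊗ₖ (g * c).1.1 : Matrix (Bits ι × Bits ι) _ ℂ)) =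
        (g.1.1 ⊗ₖ g.1.1) * (c.1.1 ⊗ₖ c.1.1) := fun c => by
    rw [← mul_kronecker_mul]; rfl
  have h1 : cliffordTwirl E = (g.1.1 ⊗ₖ g.1.1) * cliffordTwirl E * (g.1.1 ⊗ₖ g.1.1)ᴴ := by
    conv_lhs => rw [cliffordTwirl, ← Equiv.sum_comp (Equiv.mulLeft g)]
    rw [cliffordTwirl, Matrix.mul_sum, Matrix.sum_mul]
    refine Finset.sum_congr rfl fun c _ => ?_
    rw [Equiv.coe_mulLeft, hK, conjTranspose_mul]
    simp only [Matrix.mul_assoc]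
  conv_rhs => rw [h1, Matrix.mul_assoc, kronecker_conjTranspose_mul g.1.2, mul_one]

/-- The exchange of two copies of a system. -/
def swapMatrix (ι : Type) [Fintype ι] [DecidableEq ι] :
    Matrix (Bits ι × Bits ι) (Bits ι × Bits ι) ℂ :=
  Matrix.of fun p q => if p.swap = q then 1 else 0

theorem kronecker_mul_swapMatrix (M : Matrix (Bits ι) (Bits ι) ℂ) :
    (M ⊗ₖ M) * swapMatrix ι = swapMatrix ι * (M ⊗ₖ M) := by
  ext p q
  rw [Matrix.mul_apply, Matrix.mul_apply, Finset.sum_eq_single q.swap,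
    Finset.sum_eq_single p.swap]
  · simp [swapMatrix, mul_comm]
  · intro z _ hz; simp [swapMatrix, hz.symm]
  · simp
  · intro z _ hz
    have : ¬ z.swap = q := fun e => hz (by rw [← e, Prod.swap_swap])
    simp [swapMatrix, this]
  · simp

theorem kronecker_conj_cliffordTwirl {M : Matrix (Bits ι) (Bits ι) ℂ}
    (hM : M ∈ Matrix.unitaryGroup (Bits ι) ℂ)
    (E : Matrix (Bits ι × Bits ι) (Bits ι × Bits ι) ℂ) :
    (M ⊗ₖ M) * cliffordTwirl E * (M ⊗ₖ M)ᴴ = cliffordTwirl E := by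
  obtain ⟨w, hw⟩ := exists_eq_of_commute_clifford (kronecker_mul_cliffordTwirl E)
  have h : cliffordTwirl E = w false • 1 + w true • swapMatrix ι := by
    ext ⟨x, x'⟩ ⟨y, y'⟩
    rw [hw, Fintype.sum_bool, add_comm]
    simp only [PairEq, swapMatrix, Matrix.add_apply, Matrix.smul_apply, Matrix.one_apply,
      Matrix.of_apply, smul_eq_mul, Prod.mk.injEq, Prod.swap_prod_mk, if_true, Bool.false_eq_true,
      if_false]
    congr 3
    rw [and_comm]
  rw [h, Matrix.mul_add, Matrix.add_mul, Matrix.mul_smul, Matrix.mul_smul, Matrix.smul_mul,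
    Matrix.smul_mul, mul_one, kronecker_mul_swapMatrix, Matrix.mul_assoc,
    kronecker_mul_conjTranspose hM, mul_one]

theorem unitary_sum_mul_star {U : Matrix (Bits ι) (Bits ι) ℂ}
    (hU : U ∈ Matrix.unitaryGroup (Bits ι) ℂ) (s t : Bits ι) :
    ∑ r, U r s * star (U r t) = if s = t then 1 else 0 := by
  rw [Matrix.mem_unitaryGroup_iff'] at hU
  have := congrFun (congrFun hU t) s
  rw [Matrix.mul_apply, Matrix.one_apply] at this
  simp only [Matrix.star_apply] at this
  simp only [mul_comm (U _ s), this, eq_comm]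

/-- The fourth moments of a Clifford unitary followed by a fixed unitary are those of a Haar random
unitary. -/
theorem sum_clifford_moment [Nonempty ι] {W : Matrix (Bits ι) (Bits ι) ℂ}
    (hW : W ∈ Matrix.unitaryGroup (Bits ι) ℂ) (r₁ r₂ r₃ r₄ s₁ s₂ s₃ s₄ : Bits ι) :
    ∑ c : specialCliffordGroup ι, (W * c.1.1) r₁ s₁ * (W * c.1.1) r₂ s₂ *
      (star ((W * c.1.1) r₃ s₃) * star ((W * c.1.1) r₄ s₄)) =
    Fintype.card (specialCliffordGroup ι) * ∑ σ, ∑ τ, weingarten (Fintype.card (Bits ι)) σ τ *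
      ((if PairEq σ r₁ r₂ r₃ r₄ then 1 else 0) * if PairEq τ s₁ s₂ s₃ s₄ then 1 else 0) := by
  let E : Matrix (Bits ι × Bits ι) (Bits ι × Bits ι) ℂ := Matrix.single (s₁, s₂) (s₃, s₄) 1
  have hentry : ∀ (M : Matrix (Bits ι) (Bits ι) ℂ) (r₁ r₂ r₃ r₄ : Bits ι),
      ((M ⊗ₖ M) * E * (M ⊗ₖ M)ᴴ) (r₁, r₂) (r₃, r₄) =
        M r₁ s₁ * M r₂ s₂ * (star (M r₃ s₃) * star (M r₄ s₄)) := by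
    intro M r₁ r₂ r₃ r₄
    rw [Matrix.mul_apply, Finset.sum_eq_single (s₃, s₄), Matrix.mul_apply,
      Finset.sum_eq_single (s₁, s₂)]
    · simp [E, conjTranspose_apply]
    · intro z _ hz; simp [E, hz.symm]
    · simp
    · intro z _ hz
      rw [Matrix.mul_apply, Finset.sum_eq_zero, zero_mul]
      intro u _
      simp [E, hz.symm]
    · simp
  have hunit : ∀ c : specialCliffordGroup ι, W * c.1.1 ∈ Matrix.unitaryGroup (Bits ι) ℂ :=
    fun c => mul_mem hW c.1.2
  have hT : ∀ r₁ r₂ r₃ r₄, ∑ c : specialCliffordGroup ι, (W * c.1.1) r₁ s₁ * (W * c.1.1) r₂ s₂ *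
      (star ((W * c.1.1) r₃ s₃) * star ((W * c.1.1) r₄ s₄)) =
      cliffordTwirl E (r₁, r₂) (r₃, r₄) := by
    intro r₁ r₂ r₃ r₄
    rw [← kronecker_conj_cliffordTwirl hW E]
    conv_rhs => rw [cliffordTwirl, Matrix.mul_sum, Matrix.sum_mul, Matrix.sum_apply]
    refine Finset.sum_congr rfl fun c _ => ?_
    rw [← hentry, mul_kronecker_mul, conjTranspose_mul]
    simp only [Matrix.mul_assoc]
  obtain ⟨w, hw⟩ := exists_eq_of_commute_clifford (kronecker_mul_cliffordTwirl E)
  set D : ℂ := (Fintype.card (Bits ι) : ℂ) with hD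
  set N : ℂ := (Fintype.card (specialCliffordGroup ι) : ℂ) with hN
  set e : Bool → ℂ := fun τ => if PairEq τ s₁ s₂ s₃ s₄ then 1 else 0 with he
  have h1 : w false * D ^ 2 + w true * D = N * e false := by
    have hs : ∑ r, ∑ r', cliffordTwirl E (r, r') (r, r') = N * e false := by
      simp_rw [← hT]
      rw [Finset.sum_congr rfl fun r _ => Finset.sum_comm, Finset.sum_comm]
      rw [Finset.sum_congr rfl (g := fun _ => e false), Finset.sum_const, nsmul_eq_mul,
        Finset.card_univ]
      intro c _
      have h2 : e false = (if s₁ = s₃ then 1 else 0) * (if s₂ = s₄ then 1 else 0) := by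
        simp only [he, PairEq, Bool.false_eq_true, if_false]
        rw [ite_and, ite_mul, one_mul, zero_mul]
      rw [h2, ← unitary_sum_mul_star (hunit c), ← unitary_sum_mul_star (hunit c),
        Finset.sum_mul_sum]
      exact Finset.sum_congr rfl fun r _ => Finset.sum_congr rfl fun r' _ => by ring
    rw [← hs]
    simp only [hw, Fintype.sum_bool, PairEq, if_true, Bool.false_eq_true, if_false, and_self,
      Finset.sum_add_distrib, ← Finset.mul_sum]
    have h3 : ∀ r : Bits ι, ∑ r' : Bits ι, (if r = r' ∧ r' = r then (1 : ℂ) else 0) = 1 := by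
      intro r
      rw [Finset.sum_eq_single r] <;> simp +contextual [eq_comm]
    simp only [h3, Finset.sum_const, Finset.card_univ, nsmul_eq_mul, ← hD, mul_one]
    ring
  have h2 : w false * D + w true * D ^ 2 = N * e true := by
    have hs : ∑ r, ∑ r', cliffordTwirl E (r, r') (r', r) = N * e true := by
      simp_rw [← hT]
      rw [Finset.sum_congr rfl fun r _ => Finset.sum_comm, Finset.sum_comm]
      rw [Finset.sum_congr rfl (g := fun _ => e true), Finset.sum_const, nsmul_eq_mul,
        Finset.card_univ]
      intro c _
      have h2 : e true = (if s₁ = s₄ then 1 else 0) * (if s₂ = s₃ then 1 else 0) := by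
        simp only [he, PairEq, if_true]
        rw [ite_and, ite_mul, one_mul, zero_mul]
      rw [h2, ← unitary_sum_mul_star (hunit c), ← unitary_sum_mul_star (hunit c),
        Finset.sum_mul_sum]
      exact Finset.sum_congr rfl fun r _ => Finset.sum_congr rfl fun r' _ => by ring
    rw [← hs]
    simp only [hw, Fintype.sum_bool, PairEq, if_true, Bool.false_eq_true, if_false, and_self,
      Finset.sum_add_distrib, ← Finset.mul_sum]
    have h3 : ∀ r : Bits ι, ∑ r' : Bits ι, (if r = r' ∧ r' = r then (1 : ℂ) else 0) = 1 := by
      intro r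
      rw [Finset.sum_eq_single r] <;> simp +contextual [eq_comm]
    simp only [h3, Finset.sum_const, Finset.card_univ, nsmul_eq_mul, ← hD, mul_one]
    ring
  have hD2 : 2 ≤ Fintype.card (Bits ι) := by
    have : Fintype.card (Bits ι) = 2 ^ Fintype.card ι := by simp
    rw [this]
    exact Nat.le_self_pow Fintype.card_ne_zero 2
  have hD0 : D ≠ 0 := by
    rw [hD]; exact_mod_cast (by omega : Fintype.card (Bits ι) ≠ 0)
  have hD1 : D ^ 2 - 1 ≠ 0 := by
    rw [hD, sub_ne_zero]
    have : 1 < Fintype.card (Bits ι) ^ 2 := by nlinarith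
    exact_mod_cast this.ne'
  have hw0 : w false = N * (weingarten D false false * e false + weingarten D false true * e true) := by
    simp only [weingarten, if_true, Bool.false_eq_true, if_false]
    field_simp
    linear_combination D * h1 - h2
  have hw1 : w true = N * (weingarten D true false * e false + weingarten D true true * e true) := by
    simp only [weingarten, if_true, Bool.true_eq_false, if_false]
    field_simp
    linear_combination D * h2 - h1
  rw [hT, hw]
  simp only [Fintype.sum_bool, hw0, hw1, he]
  ring

theorem sum_weingarten_contract {D : ℂ} (hD0 : D ≠ 0) (hD1 : D ^ 2 - 1 ≠ 0) :
    (weingarten D false false * D + weingarten D true false) = 1 / D ∧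
      weingarten D false true * D + weingarten D true true = 0 := by
  constructor
  · simp [weingarten]; field_simp; ring
  · simp [weingarten]; field_simp; ring

/-- The second moments of a Clifford unitary followed by a fixed unitary are those of a Haar random
unitary. -/
theorem sum_clifford_second_moment [Nonempty ι] {W : Matrix (Bits ι) (Bits ι) ℂ}
    (hW : W ∈ Matrix.unitaryGroup (Bits ι) ℂ) (r r' s s' : Bits ι) :
    ∑ c : specialCliffordGroup ι, (W * c.1.1) r s * star ((W * c.1.1) r' s') =
    Fintype.card (specialCliffordGroup ι) * ((1 / Fintype.card (Bits ι)) *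
      ((if r = r' then 1 else 0) * if s = s' then 1 else 0)) := by
  have hunit : ∀ c : specialCliffordGroup ι, W * c.1.1 ∈ Matrix.unitaryGroup (Bits ι) ℂ :=
    fun c => mul_mem hW c.1.2
  have h : ∀ c : specialCliffordGroup ι, (W * c.1.1) r s * star ((W * c.1.1) r' s') =
      ∑ t, (W * c.1.1) r s * (W * c.1.1) t s *
        (star ((W * c.1.1) r' s') * star ((W * c.1.1) t s)) := by
    intro c
    have := unitary_sum_mul_star (hunit c) s s
    rw [if_pos rfl] at this
    conv_lhs => rw [← mul_one (_ * _), ← this, Finset.mul_sum]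
    exact Finset.sum_congr rfl fun t _ => by ring
  simp_rw [h]
  rw [Finset.sum_comm]
  simp_rw [sum_clifford_moment hW]
  rw [← Finset.mul_sum]
  congr 1
  set D : ℂ := (Fintype.card (Bits ι) : ℂ) with hD
  have hD2 : 2 ≤ Fintype.card (Bits ι) := by
    have : Fintype.card (Bits ι) = 2 ^ Fintype.card ι := by simp
    rw [this]
    exact Nat.le_self_pow Fintype.card_ne_zero 2
  have hD0 : D ≠ 0 := by
    rw [hD]; exact_mod_cast (by omega : Fintype.card (Bits ι) ≠ 0)
  have hD1 : D ^ 2 - 1 ≠ 0 := by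
    rw [hD, sub_ne_zero]
    have : 1 < Fintype.card (Bits ι) ^ 2 := by nlinarith
    exact_mod_cast this.ne'
  have hf : ∑ t : Bits ι, (if PairEq false r t r' t then (1 : ℂ) else 0) =
      D * if r = r' then 1 else 0 := by
    simp only [PairEq, Bool.false_eq_true, if_false, and_true, Finset.sum_const, Finset.card_univ,
      nsmul_eq_mul, ← hD]
  have ht : ∑ t : Bits ι, (if PairEq true r t r' t then (1 : ℂ) else 0) =
      if r = r' then 1 else 0 := by
    rw [Finset.sum_eq_single r]
    · simp [PairEq]
    · intro t _ ht; simp [PairEq, ht.symm]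
    · simp
  have hss : (if PairEq true s s s' s then (1 : ℂ) else 0) = if s = s' then 1 else 0 := by
    simp [PairEq]
  have hss' : (if PairEq false s s s' s then (1 : ℂ) else 0) = if s = s' then 1 else 0 := by
    simp [PairEq]
  simp only [Fintype.sum_bool, Finset.sum_add_distrib, ← Finset.mul_sum, ← Finset.sum_mul, hf, ht,
    hss, hss']
  obtain ⟨h1, h2⟩ := sum_weingarten_contract hD0 hD1
  linear_combination ((if r = r' then 1 else 0) * if s = s' then (1 : ℂ) else 0) * (h1 + h2)

theorem permOp_mul_phaseOp_mem (π : Equiv.Perm (Bits ι)) (f : Bits ι → ZMod 2) :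
    permOp π * phaseOp f ∈ Matrix.unitaryGroup (Bits ι) ℂ := by
  refine mul_mem ?_ ?_
  · rw [Matrix.mem_unitaryGroup_iff']
    ext x y
    rw [Matrix.mul_apply, Finset.sum_eq_single (π x)]
    · simp [permOp, Matrix.one_apply]
    · intro z _ hz; simp [permOp, hz]
    · simp
  · rw [Matrix.mem_unitaryGroup_iff', phaseOp, Matrix.star_eq_conjTranspose,
      Matrix.diagonal_conjTranspose, Matrix.diagonal_mul_diagonal, ← Matrix.diagonal_one]
    congr 1
    funext x
    simp [star_sgn, sgn_mul_self, Pi.star_apply, -RCLike.star_def]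

end Moments

/-! ### The isoperimetric inequality of the tiling -/

section Isoperimetry

theorem neighbor_neighbor (v : Hexagon) (i : Fin 6) : neighbor (neighbor v i) i = v :=
  hexagonCoxeter.toCoxeterSystem.simple_mul_simple_cancel_right i

/-- Reduced words of the free product of three groups of order two. -/
abbrev ReducedWord : Type := {w : List (Fin 3) // w.IsChain (· ≠ ·)}

/-- Multiplication of a reduced word by a generator. -/
def ReducedWord.toggle (i : Fin 3) : ReducedWord → ReducedWord
  | ⟨[], _⟩ => ⟨[i], by simp⟩
  | ⟨j :: w, h⟩ => if hij : i = j then ⟨w, h.tail⟩ else ⟨i :: j :: w, by simp [hij, h]⟩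

theorem ReducedWord.head_toggle (i : Fin 3) (w : ReducedWord) :
    w.1.head? = some i ∨ (w.toggle i).1.head? = some i := by
  rcases w with ⟨_ | ⟨j, w⟩, h⟩
  · simp [toggle]
  · by_cases hij : i = j
    · simp [hij]
    · simp [toggle, hij]

theorem ReducedWord.toggle_toggle (i : Fin 3) (w : ReducedWord) :
    (w.toggle i).toggle i = w := by
  rcases w with ⟨_ | ⟨j, w⟩, h⟩
  · simp [toggle]
  · by_cases hij : i = j
    · subst hij
      rcases w with _ | ⟨k, w⟩
      · simp [toggle]
      · have hik : i ≠ k := by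
          simp at h; exact h.1
        simp [toggle, hik]
    · simp [toggle, hij]

/-- The reflections in the even sides act on reduced words as the three generators, those in the
odd sides trivially. -/
def wordReflection (i : Fin 6) : Equiv.Perm ReducedWord :=
  if i.val % 2 = 0 then
    ⟨ReducedWord.toggle ⟨i.val / 2, by omega⟩, ReducedWord.toggle ⟨i.val / 2, by omega⟩,
      ReducedWord.toggle_toggle _, ReducedWord.toggle_toggle _⟩
  else 1

theorem wordReflection_mul_self (i : Fin 6) : wordReflection i * wordReflection i = 1 := by
  unfold wordReflection
  split_ifs
  · ext1 w
    exact ReducedWord.toggle_toggle _ w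
  · rfl

theorem wordReflection_isLiftable : hexagonCoxeter.IsLiftable wordReflection := by
  have hodd : ∀ i : Fin 6, i.val % 2 ≠ 0 → wordReflection i = 1 := fun i h => if_neg h
  intro i j
  change (wordReflection i * wordReflection j) ^
    (if i = j then 1 else if i = j + 1 ∨ j = i + 1 then 2 else 0) = 1
  split_ifs with h1 h2
  · rw [h1, pow_one, wordReflection_mul_self]
  · have h3 : ∀ i j : Fin 6, (i = j + 1 ∨ j = i + 1) → i.val % 2 ≠ 0 ∨ j.val % 2 ≠ 0 := by decide
    rcases h3 i j h2 with h | h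
    · rw [hodd i h, one_mul, sq, wordReflection_mul_self]
    · rw [hodd j h, mul_one, sq, wordReflection_mul_self]
  · simp

/-- The projection of the reflection group to a free product of three groups of order two, as
reduced words. -/
def Hexagon.word (v : Hexagon) : ReducedWord :=
  (hexagonCoxeter.toCoxeterSystem.lift ⟨wordReflection, wordReflection_isLiftable⟩ v)⁻¹
    ⟨[], by simp⟩

theorem Hexagon.word_neighbor (v : Hexagon) (k : Fin 3) :
    (neighbor v ⟨2 * k.val, by omega⟩).word = (Hexagon.word v).toggle k := by
  have h := hexagonCoxeter.toCoxeterSystem.lift_apply_simple wordReflection_isLiftable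
    ⟨2 * k.val, by omega⟩
  rw [CoxeterMatrix.toCoxeterSystem_simple] at h
  rw [word, neighbor, map_mul, _root_.mul_inv_rev, h, Equiv.Perm.mul_apply,
    inv_eq_of_mul_eq_one_left (wordReflection_mul_self _), wordReflection]
  simp [word]

/-- A patch has at least as many sides on its boundary as hexagons. -/
theorem card_le_card_boundary (S : Finset Hexagon) :
    S.card ≤ ((S ×ˢ univ).filter fun l : Hexagon × Fin 6 => neighbor l.1 l.2 ∉ S).card := by
  let e : Fin 3 → Fin 6 := fun k => ⟨2 * k.val, by omega⟩
  have he : Function.Injective e := by decide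
  let I := (S ×ˢ (univ : Finset (Fin 3))).filter fun l => neighbor l.1 (e l.2) ∈ S
  let O := (S ×ˢ (univ : Finset (Fin 3))).filter fun l => neighbor l.1 (e l.2) ∉ S
  let par (l : Hexagon × Fin 3) : Prop := (Hexagon.word l.1).1.head? = some l.2
  have hcard : I.card + O.card = S.card * 3 := by
    rw [Finset.card_filter_add_card_filter_not, Finset.card_product, Finset.card_univ,
      Fintype.card_fin]
  have hO : O.card ≤ ((S ×ˢ univ).filter fun l : Hexagon × Fin 6 => neighbor l.1 l.2 ∉ S).card := by
    refine Finset.card_le_card_of_injOn (fun l => (l.1, e l.2)) ?_ ?_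
    · intro l hl
      simp only [O, Finset.coe_filter, Set.mem_ofPred_eq, mem_product] at hl ⊢
      simp [hl.1.1, hl.2]
    · intro l _ l' _ h
      simp only [Prod.mk.injEq] at h
      exact Prod.ext h.1 (he h.2)
  have hpar : (I.filter par).card ≤ S.card := by
    refine Finset.card_le_card_of_injOn (fun l => l.1) ?_ ?_
    · intro l hl
      simp only [I, Finset.coe_filter, Finset.mem_filter, Set.mem_ofPred_eq, mem_product] at hl
      exact hl.1.1.1
    · intro l hl l' hl' h
      simp only [Finset.coe_filter, Set.mem_ofPred_eq, par] at hl hl'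
      change l.1 = l'.1 at h
      refine Prod.ext h ?_
      have h1 := hl.2
      rw [h, hl'.2] at h1
      exact (Option.some.inj h1).symm
  have hnot : (I.filter fun l => ¬ par l).card ≤ (I.filter par).card := by
    refine Finset.card_le_card_of_injOn (fun l => (neighbor l.1 (e l.2), l.2)) ?_ ?_
    · intro l hl
      simp only [I, Finset.coe_filter, Finset.mem_filter, Set.mem_ofPred_eq, mem_product] at hl ⊢
      refine ⟨⟨⟨hl.1.2, mem_univ _⟩, ?_⟩, ?_⟩
      · rw [neighbor_neighbor]
        exact hl.1.1.1
      · have := ReducedWord.head_toggle l.2 (Hexagon.word l.1)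
        rw [← Hexagon.word_neighbor] at this
        exact this.resolve_left hl.2
    · intro l _ l' _ h
      simp only [Prod.mk.injEq] at h
      refine Prod.ext ?_ h.2
      have h1 := h.1
      rw [← h.2] at h1
      rw [← neighbor_neighbor l.1 (e l.2), h1, neighbor_neighbor]
  have hsum : (I.filter par).card + (I.filter fun l => ¬ par l).card = I.card :=
    Finset.card_filter_add_card_filter_not _
  omega

namespace HoloNetwork

theorem card_patch_le_card_output (T : HoloNetwork) : T.patch.card ≤ Fintype.card T.Output := by
  refine (card_le_card_boundary T.patch).trans ?_
  rw [← Fintype.card_coe]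
  refine Fintype.card_le_of_injective (fun l =>
    ⟨(⟨l.1.1, ?_⟩, l.1.2), ?_⟩) ?_
  · exact (mem_product.mp (mem_filter.mp l.2).1).1
  · exact (mem_filter.mp l.2).2
  · intro l l' h
    simp only [Subtype.mk.injEq, Prod.mk.injEq] at h
    exact Subtype.ext (Prod.ext h.1 h.2)

/-- Every nonempty union of hexagons of a patch has a side on its boundary through which it is
connected to the complement. -/
theorem exists_neighbor_notMem {S : Finset Hexagon} (hS : S.Nonempty) :
    ∃ v ∈ S, ∃ i, neighbor v i ∉ S := by
  have h := (Finset.card_pos.mpr hS).trans_le (card_le_card_boundary S)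
  obtain ⟨l, hl⟩ := Finset.card_pos.mp h
  rw [mem_filter, mem_product] at hl
  exact ⟨l.1, hl.1.1, l.2, hl.2⟩

end HoloNetwork
end Isoperimetry

/-! ### Bonds of a network, and its state as a sum over bond configurations -/

section Fiberwise

variable {Z X : Type*} [Fintype Z] [Fintype X] [DecidableEq X] (res : Z → X) (f : Z → ℂ) {κ : ℂ}

theorem sum_ite_fiberwise (g : X → ℂ) :
    ∑ x, (∑ z, if res z = x then f z else 0) * g x = ∑ z, f z * g (res z) := by
  simp only [Finset.sum_mul]
  rw [Finset.sum_comm]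
  refine Finset.sum_congr rfl fun z _ => ?_
  simp only [ite_mul, zero_mul, Finset.sum_ite_eq, mem_univ, if_true]

theorem sum_mul_star_fiberwise (hκ : star κ = κ) :
    ∑ x, (κ * ∑ z, if res z = x then f z else 0) *
      star (κ * ∑ z, if res z = x then f z else 0) =
    κ ^ 2 * ∑ z, ∑ w, (if res w = res z then 1 else 0) * (f z * star (f w)) := by
  have h1 : ∀ x, (κ * ∑ z, if res z = x then f z else 0) *
      star (κ * ∑ z, if res z = x then f z else 0) =
      κ ^ 2 * ((∑ z, if res z = x then f z else 0) * star (∑ z, if res z = x then f z else 0)) := by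
    intro x
    rw [star_mul', hκ]
    ring
  simp only [h1]
  rw [← Finset.mul_sum, sum_ite_fiberwise]
  congr 1
  refine Finset.sum_congr rfl fun z _ => ?_
  rw [star_sum, Finset.mul_sum]
  refine Finset.sum_congr rfl fun w _ => ?_
  split_ifs <;> simp

theorem sum_mul_mul_star_fiberwise (hκ : star κ = κ) (m m' : X → X → X) :
    ∑ x, ∑ x', (κ * ∑ z, if res z = x then f z else 0) *
      (κ * ∑ z, if res z = x' then f z else 0) *
      (star (κ * ∑ z, if res z = m x x' then f z else 0) *
        star (κ * ∑ z, if res z = m' x x' then f z else 0)) =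
    κ ^ 4 * ∑ z, ∑ z', ∑ w, ∑ w',
      (if res w = m (res z) (res z') ∧ res w' = m' (res z) (res z') then 1 else 0) *
        (f z * f z' * (star (f w) * star (f w'))) := by
  have h1 : ∀ x x', (κ * ∑ z, if res z = x then f z else 0) *
      (κ * ∑ z, if res z = x' then f z else 0) *
      (star (κ * ∑ z, if res z = m x x' then f z else 0) *
        star (κ * ∑ z, if res z = m' x x' then f z else 0)) =
      κ ^ 4 * ((∑ z, if res z = x then f z else 0) * ((∑ z, if res z = x' then f z else 0) *
        (star (∑ z, if res z = m x x' then f z else 0) *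
          star (∑ z, if res z = m' x x' then f z else 0)))) := by
    intro x x'
    rw [star_mul', star_mul', hκ]
    ring
  simp only [h1, ← Finset.mul_sum]
  congr 1
  simp only [sum_ite_fiberwise res f fun x' => star (∑ z, if res z = m _ x' then f z else 0) *
    star (∑ z, if res z = m' _ x' then f z else 0)]
  rw [sum_ite_fiberwise res f fun x => ∑ z', f z' *
    (star (∑ z, if res z = m x (res z') then f z else 0) *
    star (∑ z, if res z = m' x (res z') then f z else 0))]
  refine Finset.sum_congr rfl fun z _ => ?_
  rw [Finset.mul_sum]
  refine Finset.sum_congr rfl fun z' _ => ?_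
  rw [star_sum, star_sum, Finset.sum_mul_sum, Finset.mul_sum, Finset.mul_sum]
  refine Finset.sum_congr rfl fun w _ => ?_
  rw [Finset.mul_sum, Finset.mul_sum]
  refine Finset.sum_congr rfl fun w' _ => ?_
  by_cases h1 : res w = m (res z) (res z')
  · by_cases h2 : res w' = m' (res z) (res z')
    · simp only [h1, h2, if_true, and_self, one_mul]
      ring
    · simp only [h1, h2, if_true, and_false, if_false, star_zero, mul_zero, zero_mul]
  · simp only [h1, false_and, if_false, star_zero, mul_zero, zero_mul]

end Fiberwise

namespace HoloNetwork

/-- The side of the tiling through which a leg passes. -/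
def side (T : HoloNetwork) (l : T.Leg) : Sym2 Hexagon × Fin 6 :=
  (s(l.1.1, neighbor l.1.1 l.2), l.2)

/-- The bonds of the network, dangling ones included: the sides of the hexagons of the patch. -/
abbrev Bond (T : HoloNetwork) : Type := {b // b ∈ univ.image T.side}

/-- The bond of a leg. -/
def bond (T : HoloNetwork) (l : T.Leg) : T.Bond :=
  ⟨T.side l, mem_image_of_mem _ (mem_univ l)⟩

theorem bond_surjective (T : HoloNetwork) : Function.Surjective T.bond := by
  rintro ⟨b, hb⟩
  obtain ⟨l, _, rfl⟩ := mem_image.mp hb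
  exact ⟨l, rfl⟩

theorem side_eq_iff (T : HoloNetwork) {l l' : T.Leg} :
    T.side l = T.side l' ↔ l' = l ∨ (l'.1.1 = neighbor l.1.1 l.2 ∧ l'.2 = l.2) := by
  simp only [side, Prod.mk.injEq, Sym2.eq_iff]
  constructor
  · rintro ⟨⟨h1, -⟩ | ⟨h1, h2⟩, h3⟩
    · exact Or.inl (Prod.ext (Subtype.ext h1.symm) h3.symm)
    · exact Or.inr ⟨h2.symm, h3.symm⟩
  · rintro (rfl | ⟨h1, h2⟩)
    · simp
    · refine ⟨Or.inr ⟨?_, h1.symm⟩, h2.symm⟩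
      rw [h1, h2, neighbor_neighbor]

theorem bond_eq_iff (T : HoloNetwork) {l l' : T.Leg} :
    T.bond l = T.bond l' ↔ l' = l ∨ (l'.1.1 = neighbor l.1.1 l.2 ∧ l'.2 = l.2) := by
  rw [← T.side_eq_iff, bond, bond, Subtype.mk.injEq]

theorem bond_neighbor (T : HoloNetwork) (l : T.Leg) (h : neighbor l.1.1 l.2 ∈ T.patch) :
    T.bond (⟨neighbor l.1.1 l.2, h⟩, l.2) = T.bond l :=
  ((T.bond_eq_iff (l := l) (l' := (⟨neighbor l.1.1 l.2, h⟩, l.2))).mpr (Or.inr ⟨rfl, rfl⟩)).symm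

theorem isInput_or (T : HoloNetwork) (l : T.Leg) :
    T.IsInput l ∨ ∃ k : Fin 3, T.leg l.1.1 (Sum.inr k) = l.2 := by
  rcases h : (T.leg l.1.1).symm l.2 with k | k
  · exact Or.inl ⟨k, by rw [← h, Equiv.apply_symm_apply]⟩
  · exact Or.inr ⟨k, by rw [← h, Equiv.apply_symm_apply]⟩

theorem not_isInput_inr (T : HoloNetwork) (v : {v // v ∈ T.patch}) (k : Fin 3) :
    ¬ T.IsInput (v, T.leg v.1 (Sum.inr k)) := by
  rintro ⟨k', h⟩
  have := (T.leg v.1).injective h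
  simp at this

theorem isInput_of_not_isInput (T : HoloNetwork) {l l' : T.Leg} (h : ¬ T.IsInput l)
    (h1 : l'.1.1 = neighbor l.1.1 l.2) (h2 : l'.2 = l.2) : T.IsInput l' := by
  obtain ⟨k, hk⟩ := (T.isInput_or l).resolve_left h
  have h3 : neighbor l.1.1 (T.leg l.1.1 (Sum.inr k)) = l'.1.1 := by rw [hk, h1]
  obtain ⟨⟨k', hk'⟩, -⟩ := T.causal l.1.1 l.1.2 k (by rw [h3]; exact l'.1.2)
  rw [h3] at hk'
  exact ⟨k', by rw [hk', hk, h2]⟩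

theorem card_bond (T : HoloNetwork) :
    Fintype.card T.Bond = T.numBell + 3 * T.patch.card := by
  have h1 : (univ.image T.side) =
      (univ.filter T.IsBell).image T.side ∪ (univ.filter fun l => ¬ T.IsInput l).image T.side := by
    ext b
    simp only [mem_image, mem_union, mem_filter, mem_univ, true_and]
    constructor
    · rintro ⟨l, rfl⟩
      by_cases hb : T.IsBell l
      · exact Or.inl ⟨l, hb, rfl⟩
      · by_cases hi : T.IsInput l
        · rw [IsBell, not_and, not_forall] at hb
          obtain ⟨h, hn⟩ := hb hi
          exact Or.inr ⟨_, hn, congrArg Subtype.val (T.bond_neighbor l h)⟩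
        · exact Or.inr ⟨l, hi, rfl⟩
    · rintro (⟨l, -, rfl⟩ | ⟨l, -, rfl⟩) <;> exact ⟨l, rfl⟩
  have h2 : Disjoint ((univ.filter T.IsBell).image T.side)
      ((univ.filter fun l => ¬ T.IsInput l).image T.side) := by
    rw [Finset.disjoint_left]
    intro b hb hb'
    simp only [mem_image, mem_filter, mem_univ, true_and] at hb hb'
    obtain ⟨l, hl, rfl⟩ := hb
    obtain ⟨l', hl', h⟩ := hb'
    rcases T.side_eq_iff.mp h.symm with rfl | ⟨h3, h4⟩
    · exact hl' hl.1
    · refine hl' ?_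
      have h5 : l' = (⟨neighbor l.1.1 l.2, h3 ▸ l'.1.2⟩, l.2) :=
        Prod.ext (Subtype.ext h3) h4
      rw [h5]
      exact hl.2 _
  have h3 : ((univ.filter fun l => ¬ T.IsInput l).image T.side).card = 3 * T.patch.card := by
    rw [Finset.card_image_of_injOn]
    · have h4 : (univ.filter fun l => ¬ T.IsInput l) =
          univ.image fun p : {v // v ∈ T.patch} × Fin 3 => (p.1, T.leg p.1.1 (Sum.inr p.2)) := by
        ext l
        simp only [mem_image, mem_filter, mem_univ, true_and]
        constructor
        · intro h
          obtain ⟨k, hk⟩ := (T.isInput_or l).resolve_left h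
          exact ⟨(l.1, k), Prod.ext rfl hk⟩
        · rintro ⟨p, rfl⟩
          exact T.not_isInput_inr p.1 p.2
      rw [h4, Finset.card_image_of_injective, Finset.card_univ, Fintype.card_prod,
        Fintype.card_coe, Fintype.card_fin, mul_comm]
      rintro ⟨v, k⟩ ⟨v', k'⟩ h
      simp only [Prod.mk.injEq] at h
      obtain ⟨rfl, h⟩ := h
      have := (T.leg v.1).injective h
      simp at this
      rw [this]
    · intro l hl l' hl' h
      simp only [coe_filter, mem_univ, true_and, Set.mem_ofPred_eq] at hl hl'
      rcases T.side_eq_iff.mp h with rfl | ⟨h3, h4⟩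
      · rfl
      · exact absurd (T.isInput_of_not_isInput hl h3 h4) hl'
  rw [Fintype.card_coe, h1, Finset.card_union_of_disjoint h2, h3]
  rfl

theorem card_bond_le (T : HoloNetwork) : Fintype.card T.Bond ≤ 6 * T.patch.card := by
  refine (Fintype.card_le_of_surjective _ T.bond_surjective).trans ?_
  simp [mul_comm]

variable {ν : ℕ}

/-- The values of a bond configuration on the output qudits. -/
def restrict (T : HoloNetwork) {Q : Type} (z : T.Bond → Q) : T.Output → Q :=
  fun l => z (T.bond l.1)

/-- The product of the gate matrix elements in a bond configuration. -/
def amplitude (T : HoloNetwork)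
    (U : {v // v ∈ T.patch} → Matrix (Bits (GateQubits ν)) (Bits (GateQubits ν)) ℂ)
    (z : T.Bond → Qudit ν) : ℂ :=
  ∏ v, U v (T.outState (z ∘ T.bond) v) (T.inState (z ∘ T.bond) v)

/-- The weight `1 / √χ` of a Bell pair. -/
def bellWeight (ν : ℕ) : ℂ := ((1 / √((2 : ℝ) ^ ν) : ℝ) : ℂ)

theorem glued_comp_bond (T : HoloNetwork) (z : T.Bond → Qudit ν) : T.Glued (z ∘ T.bond) :=
  fun l h => congrArg z (T.bond_neighbor l h)

theorem Glued.exists_comp_bond {T : HoloNetwork} {y : T.Leg → Qudit ν} (h : T.Glued y) :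
    ∃ z : T.Bond → Qudit ν, z ∘ T.bond = y := by
  refine ⟨y ∘ Function.surjInv T.bond_surjective, funext fun l => ?_⟩
  have h1 := Function.surjInv_eq T.bond_surjective (T.bond l)
  change y (Function.surjInv T.bond_surjective (T.bond l)) = y l
  rcases T.bond_eq_iff.mp h1.symm with h2 | ⟨h2, h3⟩
  · rw [h2]
  · rw [← h l (h2 ▸ (Function.surjInv T.bond_surjective (T.bond l)).1.2)]
    exact congrArg y (Prod.ext (Subtype.ext h2) h3)

theorem state_eq_sum (T : HoloNetwork)
    (U : {v // v ∈ T.patch} → Matrix (Bits (GateQubits ν)) (Bits (GateQubits ν)) ℂ)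
    (x : T.Output → Qudit ν) :
    T.state U x = bellWeight ν ^ T.numBell *
      ∑ z : T.Bond → Qudit ν, if T.restrict z = x then T.amplitude U z else 0 := by
  rw [state, ← Finset.sum_filter]
  congr 1
  symm
  refine Finset.sum_bij (fun z _ => z ∘ T.bond) ?_ ?_ ?_ ?_
  · intro z hz
    simp only [mem_filter, mem_univ, true_and] at hz ⊢
    exact ⟨T.glued_comp_bond z, fun l => congrFun hz l⟩
  · intro z _ z' _ h
    exact T.bond_surjective.injective_comp_right h
  · intro y hy
    simp only [mem_filter, mem_univ, true_and] at hy
    obtain ⟨z, rfl⟩ := hy.1.exists_comp_bond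
    exact ⟨z, mem_filter.mpr ⟨mem_univ _, funext hy.2⟩, rfl⟩
  · intro z _
    rfl

theorem reducedTrace_state (T : HoloNetwork)
    (U : {v // v ∈ T.patch} → Matrix (Bits (GateQubits ν)) (Bits (GateQubits ν)) ℂ)
    (A : Finset T.Output) :
    reducedTrace (T.state U) A = (bellWeight ν ^ T.numBell) ^ 2 *
      ∑ z : T.Bond → Qudit ν, ∑ w : T.Bond → Qudit ν, (if T.restrict w = T.restrict z then 1 else 0) *
        (T.amplitude U z * star (T.amplitude U w)) := by
  have hb : star (bellWeight ν ^ T.numBell) = bellWeight ν ^ T.numBell := by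
    rw [star_pow, bellWeight, Complex.star_def, Complex.conj_ofReal]
  rw [reducedTrace_eq_sum]
  simp only [T.state_eq_sum]
  exact sum_mul_star_fiberwise T.restrict (T.amplitude U) hb

theorem purity_state (T : HoloNetwork)
    (U : {v // v ∈ T.patch} → Matrix (Bits (GateQubits ν)) (Bits (GateQubits ν)) ℂ)
    (A : Finset T.Output) :
    purity (T.state U) A =
      (bellWeight ν ^ T.numBell) ^ 4 *
      ∑ z : T.Bond → Qudit ν, ∑ z' : T.Bond → Qudit ν, ∑ w : T.Bond → Qudit ν,
        ∑ w' : T.Bond → Qudit ν,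
        (if ∀ l, PairEq (decide (l ∈ A)) (T.restrict z l) (T.restrict z' l) (T.restrict w l)
          (T.restrict w' l) then 1 else 0) *
        (T.amplitude U z * T.amplitude U z' * (star (T.amplitude U w) * star (T.amplitude U w'))) := by
  have hb : star (bellWeight ν ^ T.numBell) = bellWeight ν ^ T.numBell := by
    rw [star_pow, bellWeight, Complex.star_def, Complex.conj_ofReal]
  have hiff : ∀ x x' y y' : T.Output → Qudit ν,
      (∀ l, PairEq (decide (l ∈ A)) (x l) (x' l) (y l) (y' l)) ↔
        y = merge A x' x ∧ y' = merge A x x' := by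
    intro x x' y y'
    rw [funext_iff, funext_iff, ← forall_and]
    refine forall_congr' fun l => ?_
    by_cases h : l ∈ A <;> simp [PairEq, merge, h, eq_comm, and_comm]
  rw [purity_eq_sum]
  simp only [T.state_eq_sum, hiff]
  exact sum_mul_mul_star_fiberwise T.restrict (T.amplitude U) hb (fun x x' => merge A x' x)
    fun x x' => merge A x x'

end HoloNetwork

namespace HoloNetwork

/-! ### Averages over the gates -/

variable {ν : ℕ}

/-- The random data of a PFC gate. -/
abbrev GateData (ν : ℕ) : Type :=
  Equiv.Perm (Bits (GateQubits ν)) × (Bits (GateQubits ν) → ZMod 2) ×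
    specialCliffordGroup (GateQubits ν)

instance : Fintype (GateData ν) :=
  @instFintypeProd _ _ inferInstance (@instFintypeProd _ _ inferInstance inferInstance)

/-- The gate with given data. -/
def GateData.gate (g : GateData ν) : Matrix (Bits (GateQubits ν)) (Bits (GateQubits ν)) ℂ :=
  pfcGate g.1 g.2.1 g.2.2

/-- The probability of the data of a gate. -/
def gateLaw (P : PMF (Equiv.Perm (Bits (GateQubits ν)))) (F : PMF (Bits (GateQubits ν) → ZMod 2))
    (g : GateData ν) : ℝ :=
  (P g.1).toReal * (F g.2.1).toReal *
    (1 / (Fintype.card (specialCliffordGroup (GateQubits ν)) : ℝ))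

/-- The expectation over independent gates. -/
def average (T : HoloNetwork) (P : PMF (Equiv.Perm (Bits (GateQubits ν))))
    (F : PMF (Bits (GateQubits ν) → ZMod 2))
    (h : ({v // v ∈ T.patch} → Matrix (Bits (GateQubits ν)) (Bits (GateQubits ν)) ℂ) → ℝ) : ℝ :=
  ∑ ω : {v // v ∈ T.patch} → GateData ν, (∏ v, gateLaw P F (ω v)) * h fun v => (ω v).gate

theorem sum_arrow_prod_prod {α β γ δ : Type*} [Fintype α] [DecidableEq α] [Fintype β] [Fintype γ]
    [Fintype δ] (h : (α → β × γ × δ) → ℝ) :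
    ∑ ω, h ω = ∑ f : α → β, ∑ g : α → γ, ∑ k : α → δ, h fun a => (f a, g a, k a) := by
  rw [← (Equiv.arrowProdEquivProdArrow α (fun _ => β) (fun _ => γ × δ)).symm.sum_comp,
    Fintype.sum_prod_type]
  refine Finset.sum_congr rfl fun f _ => ?_
  rw [← (Equiv.arrowProdEquivProdArrow α (fun _ => γ) (fun _ => δ)).symm.sum_comp,
    Fintype.sum_prod_type]
  rfl

theorem expectedEntropy_eq_average (T : HoloNetwork) (P : PMF (Equiv.Perm (Bits (GateQubits ν))))
    (F : PMF (Bits (GateQubits ν) → ZMod 2)) (A : Finset T.Output) :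
    T.expectedEntropy P F A = T.average P F fun U => entanglementEntropy (T.state U) A := by
  rw [average, sum_arrow_prod_prod]
  simp only [gateLaw, GateData.gate]
  rfl

theorem sum_toReal_pmf {α : Type*} [Fintype α] (p : PMF α) : ∑ a, (p a).toReal = 1 := by
  rw [← ENNReal.toReal_sum fun a _ => p.apply_ne_top a, ← tsum_fintype (L := .unconditional _),
    p.tsum_coe, ENNReal.toReal_one]

section Law

variable (P : PMF (Equiv.Perm (Bits (GateQubits ν)))) (F : PMF (Bits (GateQubits ν) → ZMod 2))

theorem gateLaw_nonneg (g : GateData ν) : 0 ≤ gateLaw P F g := by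
  unfold gateLaw; positivity

/-- If the average over the Clifford unitary does not depend on the permutation and the phase, it
is the average over the gate. -/
theorem sum_gateLaw_mul (h : GateData ν → ℂ) (a : ℂ)
    (hc : ∀ π f, ∑ c, h (π, f, c) =
      Fintype.card (specialCliffordGroup (GateQubits ν)) * a) :
    ∑ g, (gateLaw P F g : ℂ) * h g = a := by
  have hcard : (Fintype.card (specialCliffordGroup (GateQubits ν)) : ℂ) ≠ 0 := by
    exact_mod_cast Fintype.card_ne_zero
  rw [Fintype.sum_prod_type]
  simp only [Fintype.sum_prod_type, gateLaw, Complex.ofReal_mul, mul_assoc, ← Finset.mul_sum, hc]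
  simp only [← Finset.sum_mul, ← Complex.ofReal_sum, sum_toReal_pmf]
  push_cast
  field_simp

theorem sum_gateLaw : ∑ g : GateData ν, gateLaw P F g = 1 := by
  have h := sum_gateLaw_mul P F (fun _ => 1) 1 (by simp)
  simp only [mul_one, ← Complex.ofReal_sum] at h
  exact_mod_cast h

theorem average_mono (T : HoloNetwork) {h h' : _ → ℝ} (hh : ∀ U, h U ≤ h' U) :
    T.average P F h ≤ T.average P F h' :=
  Finset.sum_le_sum fun _ _ =>
    mul_le_mul_of_nonneg_left (hh _) (Finset.prod_nonneg fun _ _ => gateLaw_nonneg P F _)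

theorem average_add (T : HoloNetwork) (h h' : _ → ℝ) :
    T.average P F (fun U => h U + h' U) = T.average P F h + T.average P F h' := by
  simp only [average, mul_add, Finset.sum_add_distrib]

theorem average_const_mul (T : HoloNetwork) (a : ℝ) (h : _ → ℝ) :
    T.average P F (fun U => a * h U) = a * T.average P F h := by
  simp only [average, Finset.mul_sum]
  exact Finset.sum_congr rfl fun _ _ => by ring

theorem sum_prod_eq_prod_sum (T : HoloNetwork) (h : {v // v ∈ T.patch} → GateData ν → ℂ) :
    ∑ ω : {v // v ∈ T.patch} → GateData ν, ∏ v, h v (ω v) = ∏ v, ∑ g, h v g := by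
  rw [Finset.prod_univ_sum, Fintype.piFinset_univ]

theorem average_const (T : HoloNetwork) (a : ℝ) : T.average P F (fun _ => a) = a := by
  have h := T.sum_prod_eq_prod_sum fun _ g => (gateLaw P F g : ℂ)
  simp only [← Complex.ofReal_prod, ← Complex.ofReal_sum, sum_gateLaw, Finset.prod_const_one] at h
  rw [average, ← Finset.sum_mul, show (∑ ω : {v // v ∈ T.patch} → GateData ν,
    ∏ v, gateLaw P F (ω v)) = 1 by exact_mod_cast h, one_mul]

theorem average_re (T : HoloNetwork)
    (h : ({v // v ∈ T.patch} → Matrix (Bits (GateQubits ν)) (Bits (GateQubits ν)) ℂ) → ℂ) :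
    T.average P F (fun U => (h U).re) =
      (∑ ω : {v // v ∈ T.patch} → GateData ν,
        (∏ v, (gateLaw P F (ω v) : ℂ)) * h fun v => (ω v).gate).re := by
  rw [average, Complex.re_sum]
  refine Finset.sum_congr rfl fun ω _ => ?_
  rw [← Complex.ofReal_prod, Complex.re_ofReal_mul]

theorem sum_gateLaw_second_moment (hν : 0 < ν) (r r' s s' : Bits (GateQubits ν)) :
    ∑ g : GateData ν, (gateLaw P F g : ℂ) * (g.gate r s * star (g.gate r' s')) =
      (1 / Fintype.card (Bits (GateQubits ν))) *
        ((if r = r' then 1 else 0) * if s = s' then 1 else 0) := by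
  have : Nonempty (GateQubits ν) := ⟨(0, ⟨0, hν⟩)⟩
  exact sum_gateLaw_mul P F _ _ fun π f =>
    sum_clifford_second_moment (permOp_mul_phaseOp_mem π f) r r' s s'

theorem sum_gateLaw_fourth_moment (hν : 0 < ν) (r₁ r₂ r₃ r₄ s₁ s₂ s₃ s₄ : Bits (GateQubits ν)) :
    ∑ g : GateData ν, (gateLaw P F g : ℂ) * (g.gate r₁ s₁ * g.gate r₂ s₂ *
      (star (g.gate r₃ s₃) * star (g.gate r₄ s₄))) =
      ∑ σ, ∑ τ, weingarten (Fintype.card (Bits (GateQubits ν))) σ τ *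
        ((if PairEq σ r₁ r₂ r₃ r₄ then 1 else 0) * if PairEq τ s₁ s₂ s₃ s₄ then 1 else 0) := by
  have : Nonempty (GateQubits ν) := ⟨(0, ⟨0, hν⟩)⟩
  exact sum_gateLaw_mul P F _ _ fun π f =>
    sum_clifford_moment (permOp_mul_phaseOp_mem π f) r₁ r₂ r₃ r₄ s₁ s₂ s₃ s₄

theorem bellWeight_sq : bellWeight ν ^ 2 = ((2 : ℂ) ^ ν)⁻¹ := by
  rw [bellWeight, ← Complex.ofReal_pow, div_pow, Real.sq_sqrt (by positivity)]
  simp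

theorem card_gateBits : Fintype.card (Bits (GateQubits ν)) = (2 ^ ν) ^ 3 := by
  simp [← pow_mul, mul_comm]

theorem card_qudit : Fintype.card (Qudit ν) = 2 ^ ν := by
  simp

theorem ext_of_outState_inState (T : HoloNetwork) {z w : T.Bond → Qudit ν}
    (ho : ∀ v, T.outState (z ∘ T.bond) v = T.outState (w ∘ T.bond) v)
    (hi : ∀ v, T.inState (z ∘ T.bond) v = T.inState (w ∘ T.bond) v) : z = w := by
  funext b
  obtain ⟨l, rfl⟩ := T.bond_surjective b
  rcases h : (T.leg l.1.1).symm l.2 with k | k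
  · have hl : l = (l.1, T.leg l.1.1 (Sum.inl k)) :=
      Prod.ext rfl (by rw [← h, Equiv.apply_symm_apply])
    rw [hl]
    exact funext fun q => congrFun (hi l.1) (k, q)
  · have hl : l = (l.1, T.leg l.1.1 (Sum.inr k)) :=
      Prod.ext rfl (by rw [← h, Equiv.apply_symm_apply])
    rw [hl]
    exact funext fun q => congrFun (ho l.1) (k, q)

theorem average_reducedTrace (T : HoloNetwork) (hν : 0 < ν) (A : Finset T.Output) :
    T.average P F (fun U => (reducedTrace (T.state U) A).re) = 1 := by
  rw [average_re]
  simp only [T.reducedTrace_state]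
  have h1 : ∀ ω : {v // v ∈ T.patch} → GateData ν,
      (∏ v, (gateLaw P F (ω v) : ℂ)) * ((bellWeight ν ^ T.numBell) ^ 2 *
      ∑ z : T.Bond → Qudit ν, ∑ w : T.Bond → Qudit ν, (if T.restrict w = T.restrict z then 1 else 0) *
        (T.amplitude (fun v => (ω v).gate) z * star (T.amplitude (fun v => (ω v).gate) w))) =
      (bellWeight ν ^ T.numBell) ^ 2 * ∑ z : T.Bond → Qudit ν, ∑ w : T.Bond → Qudit ν,
        (if T.restrict w = T.restrict z then 1 else 0) * ∏ v, ((gateLaw P F (ω v) : ℂ) *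
          ((ω v).gate (T.outState (z ∘ T.bond) v) (T.inState (z ∘ T.bond) v) *
            star ((ω v).gate (T.outState (w ∘ T.bond) v) (T.inState (w ∘ T.bond) v)))) := by
    intro ω
    rw [mul_left_comm, Finset.mul_sum]
    congr 1
    refine Finset.sum_congr rfl fun z _ => ?_
    rw [Finset.mul_sum]
    refine Finset.sum_congr rfl fun w _ => ?_
    rw [mul_left_comm, Finset.prod_mul_distrib, Finset.prod_mul_distrib, amplitude, amplitude,
      star_prod]
  simp only [h1]
  rw [← Finset.mul_sum, Finset.sum_comm]
  have h2 : ∀ z w : T.Bond → Qudit ν, ∑ ω : {v // v ∈ T.patch} → GateData ν,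
      (if T.restrict w = T.restrict z then 1 else 0) * ∏ v, ((gateLaw P F (ω v) : ℂ) *
          ((ω v).gate (T.outState (z ∘ T.bond) v) (T.inState (z ∘ T.bond) v) *
            star ((ω v).gate (T.outState (w ∘ T.bond) v) (T.inState (w ∘ T.bond) v)))) =
      if z = w then (1 / (((2 : ℂ) ^ ν) ^ 3)) ^ T.patch.card else 0 := by
    intro z w
    rw [← Finset.mul_sum, T.sum_prod_eq_prod_sum fun v g => (gateLaw P F g : ℂ) *
          (g.gate (T.outState (z ∘ T.bond) v) (T.inState (z ∘ T.bond) v) *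
            star (g.gate (T.outState (w ∘ T.bond) v) (T.inState (w ∘ T.bond) v)))]
    simp only [sum_gateLaw_second_moment P F hν]
    by_cases h : z = w
    · subst h
      simp only [if_true, mul_one, Finset.prod_const, Finset.card_univ, card_gateBits,
        Fintype.card_coe, one_mul]
      push_cast
      rfl
    · rw [if_neg h]
      by_contra hne
      refine h (T.ext_of_outState_inState (fun v => ?_) fun v => ?_)
      all_goals
        by_contra hv
        refine hne ?_
        rw [Finset.prod_eq_zero (mem_univ v), mul_zero]
        simp only [hv, if_false, mul_zero, zero_mul]
  have h3 : ∀ z : T.Bond → Qudit ν, ∑ ω : {v // v ∈ T.patch} → GateData ν,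
      ∑ w : T.Bond → Qudit ν,
      (if T.restrict w = T.restrict z then 1 else 0) * ∏ v, ((gateLaw P F (ω v) : ℂ) *
          ((ω v).gate (T.outState (z ∘ T.bond) v) (T.inState (z ∘ T.bond) v) *
            star ((ω v).gate (T.outState (w ∘ T.bond) v) (T.inState (w ∘ T.bond) v)))) =
      (1 / (((2 : ℂ) ^ ν) ^ 3)) ^ T.patch.card := by
    intro z
    rw [Finset.sum_comm]
    simp only [h2, Finset.sum_ite_eq, mem_univ, if_true]
  have hc : (Fintype.card (T.Bond → Qudit ν) : ℂ) =
      ((2 : ℂ) ^ ν) ^ (T.numBell + 3 * T.patch.card) := by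
    rw [Fintype.card_fun, card_qudit, T.card_bond]
    push_cast
    rfl
  simp only [h3, Finset.sum_const, Finset.card_univ, nsmul_eq_mul, hc]
  rw [← pow_mul, mul_comm T.numBell, pow_mul, bellWeight_sq]
  have h4 : ((2 : ℂ) ^ ν) ≠ 0 := pow_ne_zero _ two_ne_zero
  have h5 : (((2 : ℂ) ^ ν)⁻¹ ^ T.numBell * (((2 : ℂ) ^ ν) ^ (T.numBell + 3 * T.patch.card) *
      (1 / ((2 : ℂ) ^ ν) ^ 3) ^ T.patch.card)) = 1 := by
    rw [pow_add, pow_mul _ 3, one_div, inv_pow, inv_pow]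
    field_simp
  rw [h5, Complex.one_re]

end Law

end HoloNetwork

namespace HoloNetwork

/-! ### The average purity as a partition function of Ising spins -/

variable {ν : ℕ}

/-- A spin for the outgoing legs and a spin for the incoming legs of each gate. -/
abbrev Spins (T : HoloNetwork) : Type := {v // v ∈ T.patch} → Bool × Bool

/-- The spin of a leg. -/
def legSpin (T : HoloNetwork) (g : T.Spins) (l : T.Leg) : Bool :=
  if T.IsInput l then (g l.1).2 else (g l.1).1

/-- One end of the bond has the given spin; the output qudits in `A` have spin `true`, the others
have spin `false`. -/
def HasSpin (T : HoloNetwork) (A : Finset T.Output) (g : T.Spins) (b : T.Bond) (s : Bool) : Prop :=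
  (∃ l : T.Leg, T.bond l = b ∧ T.legSpin g l = s) ∨
    ∃ l : T.Output, T.bond l.1 = b ∧ decide (l ∈ A) = s

/-- The bonds whose ends have different spins. -/
def walls (T : HoloNetwork) (A : Finset T.Output) (g : T.Spins) : Finset T.Bond :=
  univ.filter fun b => T.HasSpin A g b true ∧ T.HasSpin A g b false

/-- The gates whose outgoing and incoming spins are different. -/
def flips (T : HoloNetwork) (g : T.Spins) : Finset {v // v ∈ T.patch} :=
  univ.filter fun v => (g v).1 ≠ (g v).2

/-- The energy of a spin configuration. -/
def energy (T : HoloNetwork) (A : Finset T.Output) (g : T.Spins) : ℕ :=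
  (T.walls A g).card + 3 * (T.flips g).card

/-- Four bond configurations. -/
abbrev Replicas (T : HoloNetwork) (ν : ℕ) : Type :=
  (T.Bond → Qudit ν) × (T.Bond → Qudit ν) × (T.Bond → Qudit ν) × (T.Bond → Qudit ν)

instance (T : HoloNetwork) (ν : ℕ) : Fintype (T.Replicas ν) :=
  @instFintypeProd _ _ inferInstance (@instFintypeProd _ _ inferInstance
    (@instFintypeProd _ _ inferInstance inferInstance))

/-- Four bond configurations are paired as prescribed by the spins. -/
def Consistent (T : HoloNetwork) (A : Finset T.Output) (g : T.Spins)
    (p : T.Replicas ν) :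
    Prop :=
  (∀ l, PairEq (decide (l ∈ A)) (T.restrict p.1 l) (T.restrict p.2.1 l) (T.restrict p.2.2.1 l)
    (T.restrict p.2.2.2 l)) ∧
  ∀ v, PairEq (g v).1 (T.outState (p.1 ∘ T.bond) v) (T.outState (p.2.1 ∘ T.bond) v)
      (T.outState (p.2.2.1 ∘ T.bond) v) (T.outState (p.2.2.2 ∘ T.bond) v) ∧
    PairEq (g v).2 (T.inState (p.1 ∘ T.bond) v) (T.inState (p.2.1 ∘ T.bond) v)
      (T.inState (p.2.2.1 ∘ T.bond) v) (T.inState (p.2.2.2 ∘ T.bond) v)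

theorem _root_.PairEq.map {α β : Type*} (f : α → β) {s : Bool} {x x' y y' : α}
    (h : PairEq s x x' y y') : PairEq s (f x) (f x') (f y) (f y') := by
  unfold PairEq at h ⊢
  split_ifs at h ⊢ <;> simp [h.1, h.2]

theorem Consistent.pairEq {T : HoloNetwork} {A : Finset T.Output} {g : T.Spins}
    {p : T.Replicas ν}
    (h : T.Consistent A g p) {b : T.Bond} {s : Bool} (hs : T.HasSpin A g b s) :
    PairEq s (p.1 b) (p.2.1 b) (p.2.2.1 b) (p.2.2.2 b) := by
  rcases hs with ⟨l, rfl, rfl⟩ | ⟨l, rfl, rfl⟩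
  · by_cases hi : T.IsInput l
    · obtain ⟨k, hk⟩ := id hi
      have hl : (l.1, T.leg l.1.1 (Sum.inl k)) = l := Prod.ext rfl hk
      have h1 := (h.2 l.1).2.map fun x : Bits (GateQubits ν) => fun q => x (k, q)
      simp only [inState, Function.comp_apply, hl] at h1
      rw [legSpin, if_pos hi]
      exact h1
    · obtain ⟨k, hk⟩ := (T.isInput_or l).resolve_left hi
      have hl : (l.1, T.leg l.1.1 (Sum.inr k)) = l := Prod.ext rfl hk
      have h1 := (h.2 l.1).1.map fun x : Bits (GateQubits ν) => fun q => x (k, q)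
      simp only [outState, Function.comp_apply, hl] at h1
      rw [legSpin, if_neg hi]
      exact h1
  · exact h.1 l

theorem card_pairEq_le {Q : Type*} [Fintype Q] (S : Bool → Prop) (h : ∃ s, S s) :
    ((univ : Finset (Q × Q × Q × Q)).filter fun q =>
      ∀ s, S s → PairEq s q.1 q.2.1 q.2.2.1 q.2.2.2).card *
      Fintype.card Q ^ (if S true ∧ S false then 1 else 0) ≤ Fintype.card Q ^ 2 := by
  split_ifs with hS
  · rw [pow_one, sq]
    refine Nat.mul_le_mul_right _ ?_
    rw [← Finset.card_univ (α := Q)]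
    refine Finset.card_le_card_of_injOn (fun q => q.1) (fun _ _ => mem_coe.mpr (mem_univ _)) ?_
    rintro ⟨x, x', y, y'⟩ h1 ⟨u, u', w, w'⟩ h2 h3
    simp only [coe_filter, mem_univ, true_and, Set.mem_ofPred_eq] at h1 h2 h3
    have e1 := h1 true hS.1
    have e2 := h1 false hS.2
    have e3 := h2 true hS.1
    have e4 := h2 false hS.2
    simp only [PairEq, if_true, Bool.false_eq_true, if_false] at e1 e2 e3 e4
    obtain ⟨rfl, rfl⟩ := e1
    obtain ⟨rfl, -⟩ := e2
    obtain ⟨rfl, rfl⟩ := e3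
    obtain ⟨rfl, -⟩ := e4
    rw [h3]
  · rw [pow_zero, mul_one, sq, ← Fintype.card_prod, ← Finset.card_univ]
    refine Finset.card_le_card_of_injOn (fun q => (q.1, q.2.1))
      (fun _ _ => mem_coe.mpr (mem_univ _)) ?_
    obtain ⟨s, hs⟩ := h
    rintro ⟨x, x', y, y'⟩ h1 ⟨u, u', w, w'⟩ h2 h3
    simp only [coe_filter, mem_univ, true_and, Set.mem_ofPred_eq, Prod.mk.injEq] at h1 h2 h3
    have e1 := h1 s hs
    have e2 := h2 s hs
    obtain ⟨rfl, rfl⟩ := h3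
    unfold PairEq at e1 e2
    split_ifs at e1 e2 <;> simp [← e1.1, ← e1.2, ← e2.1, ← e2.2]

theorem card_consistent_mul_le (T : HoloNetwork) (A : Finset T.Output) (g : T.Spins) :
    (univ.filter fun p : T.Replicas ν => T.Consistent A g p).card * (2 ^ ν) ^ (T.walls A g).card ≤
      ((2 ^ ν) ^ 2) ^ Fintype.card T.Bond := by
  let S : T.Bond → Finset (Qudit ν × Qudit ν × Qudit ν × Qudit ν) := fun b =>
    univ.filter fun q => ∀ s, T.HasSpin A g b s → PairEq s q.1 q.2.1 q.2.2.1 q.2.2.2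
  have h1 : (univ.filter fun p : T.Replicas ν => T.Consistent A g p).card ≤ (Fintype.piFinset S).card := by
    refine Finset.card_le_card_of_injOn (fun p b => (p.1 b, p.2.1 b, p.2.2.1 b, p.2.2.2 b)) ?_ ?_
    · intro p hp
      simp only [coe_filter, mem_univ, true_and, Set.mem_ofPred_eq] at hp
      rw [mem_coe, Fintype.mem_piFinset]
      intro b
      simp only [S, mem_filter, mem_univ, true_and]
      exact fun s hs => hp.pairEq hs
    · rintro ⟨z, z', w, w'⟩ _ ⟨u, u', t, t'⟩ _ h
      simp only [funext_iff, Prod.mk.injEq] at h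
      simp only [Prod.mk.injEq]
      exact ⟨funext fun b => funext (h b).1, funext fun b => funext (h b).2.1,
        funext fun b => funext (h b).2.2.1, funext fun b => funext (h b).2.2.2⟩
  refine (Nat.mul_le_mul_right _ h1).trans ?_
  have h2 : (2 ^ ν) ^ (T.walls A g).card = ∏ b : T.Bond,
      (2 ^ ν) ^ (if T.HasSpin A g b true ∧ T.HasSpin A g b false then 1 else 0) := by
    rw [Finset.prod_pow_eq_pow_sum, walls, Finset.card_filter]
  rw [Fintype.card_piFinset, h2, ← Finset.prod_mul_distrib]
  have h3 := Finset.prod_le_pow_card (univ : Finset T.Bond)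
    (fun b => (S b).card * (2 ^ ν) ^ (if T.HasSpin A g b true ∧ T.HasSpin A g b false then 1 else 0))
    ((2 ^ ν) ^ 2) ?_
  · rwa [Finset.card_univ] at h3
  · intro b _
    have h4 := card_pairEq_le (Q := Qudit ν) (T.HasSpin A g b) (by
      obtain ⟨l, rfl⟩ := T.bond_surjective b
      exact ⟨_, Or.inl ⟨l, rfl, rfl⟩⟩)
    rw [card_qudit] at h4
    convert h4

theorem sum_prod_prod_prod {α M : Type*} [Fintype α] [AddCommMonoid M] (f : α → α → α → α → M) :
    ∑ a, ∑ b, ∑ c, ∑ d, f a b c d = ∑ p : α × α × α × α, f p.1 p.2.1 p.2.2.1 p.2.2.2 := by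
  simp only [Fintype.sum_prod_type]

variable (P : PMF (Equiv.Perm (Bits (GateQubits ν)))) (F : PMF (Bits (GateQubits ν) → ZMod 2))

theorem average_purity_eq (T : HoloNetwork) (hν : 0 < ν) (A : Finset T.Output) :
    T.average P F (fun U => (purity (T.state U) A).re) =
      ((bellWeight ν ^ T.numBell) ^ 4 * ∑ g : T.Spins,
        (∏ v, weingarten (Fintype.card (Bits (GateQubits ν))) (g v).1 (g v).2) *
        ((univ.filter fun p : T.Replicas ν => T.Consistent A g p).card : ℂ)).re := by
  rw [average_re]
  congr 1
  simp only [T.purity_state, sum_prod_prod_prod (α := T.Bond → Qudit ν)]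
  simp only [mul_left_comm _ ((bellWeight ν ^ T.numBell) ^ 4)]
  rw [← Finset.mul_sum]
  congr 1
  simp only [Finset.mul_sum]
  rw [Finset.sum_comm]
  have h1 : ∀ p : T.Replicas ν, ∑ ω : {v // v ∈ T.patch} → GateData ν,
      (∏ v, (gateLaw P F (ω v) : ℂ)) *
        ((if ∀ l, PairEq (decide (l ∈ A)) (T.restrict p.1 l) (T.restrict p.2.1 l)
          (T.restrict p.2.2.1 l) (T.restrict p.2.2.2 l) then 1 else 0) *
        (T.amplitude (fun v => (ω v).gate) p.1 * T.amplitude (fun v => (ω v).gate) p.2.1 *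
          (star (T.amplitude (fun v => (ω v).gate) p.2.2.1) *
            star (T.amplitude (fun v => (ω v).gate) p.2.2.2)))) =
      ∑ g : T.Spins, (∏ v, weingarten (Fintype.card (Bits (GateQubits ν))) (g v).1 (g v).2) *
        if T.Consistent A g p then 1 else 0 := by
    intro p
    have e1 : ∀ ω : {v // v ∈ T.patch} → GateData ν, (∏ v, (gateLaw P F (ω v) : ℂ)) *
        (T.amplitude (fun v => (ω v).gate) p.1 * T.amplitude (fun v => (ω v).gate) p.2.1 *
          (star (T.amplitude (fun v => (ω v).gate) p.2.2.1) *
            star (T.amplitude (fun v => (ω v).gate) p.2.2.2))) =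
        ∏ v, ((gateLaw P F (ω v) : ℂ) *
          ((ω v).gate (T.outState (p.1 ∘ T.bond) v) (T.inState (p.1 ∘ T.bond) v) *
          (ω v).gate (T.outState (p.2.1 ∘ T.bond) v) (T.inState (p.2.1 ∘ T.bond) v) *
          (star ((ω v).gate (T.outState (p.2.2.1 ∘ T.bond) v) (T.inState (p.2.2.1 ∘ T.bond) v)) *
          star ((ω v).gate (T.outState (p.2.2.2 ∘ T.bond) v)
            (T.inState (p.2.2.2 ∘ T.bond) v))))) := by
      intro ω
      simp only [amplitude, star_prod, Finset.prod_mul_distrib]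
    have e2 := T.sum_prod_eq_prod_sum fun v (g : GateData ν) => (gateLaw P F g : ℂ) *
          (g.gate (T.outState (p.1 ∘ T.bond) v) (T.inState (p.1 ∘ T.bond) v) *
          g.gate (T.outState (p.2.1 ∘ T.bond) v) (T.inState (p.2.1 ∘ T.bond) v) *
          (star (g.gate (T.outState (p.2.2.1 ∘ T.bond) v) (T.inState (p.2.2.1 ∘ T.bond) v)) *
          star (g.gate (T.outState (p.2.2.2 ∘ T.bond) v) (T.inState (p.2.2.2 ∘ T.bond) v))))
    simp only [mul_left_comm _ (ite _ _ _ : ℂ), e1]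
    rw [← Finset.mul_sum, e2]
    simp only [sum_gateLaw_fourth_moment P F hν]
    simp only [← Fintype.sum_prod_type']
    rw [Finset.prod_univ_sum, Fintype.piFinset_univ, Finset.mul_sum]
    refine Finset.sum_congr rfl fun g _ => ?_
    rw [Finset.prod_mul_distrib, mul_left_comm]
    congr 1
    by_cases hc : T.Consistent A g p
    · rw [if_pos hc, if_pos hc.1, one_mul]
      refine Finset.prod_eq_one fun v _ => ?_
      rw [if_pos (hc.2 v).1, if_pos (hc.2 v).2, one_mul]
    · rw [if_neg hc]
      rw [Consistent, not_and_or] at hc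
      rcases hc with h | h
      · rw [if_neg h, zero_mul]
      · obtain ⟨v, hv⟩ := not_forall.mp h
        rw [not_and_or] at hv
        rw [Finset.prod_eq_zero (mem_univ v), mul_zero]
        rcases hv with hv | hv
        · rw [if_neg hv, zero_mul]
        · rw [if_neg hv, mul_zero]
  simp only [h1]
  rw [Finset.sum_comm]
  refine Finset.sum_congr rfl fun g _ => ?_
  rw [← Finset.mul_sum, Finset.sum_boole]

theorem norm_weingarten {D : ℕ} (hD : 2 ≤ D) (s t : Bool) :
    ‖weingarten (D : ℂ) s t‖ = (D ^ 2 / (D ^ 2 - 1) : ℝ) * ((D : ℝ) ^ 2)⁻¹ *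
      (D : ℝ)⁻¹ ^ (if s ≠ t then 1 else 0) := by
  have h2 : (2 : ℝ) ≤ D := by exact_mod_cast hD
  have h1 : (0 : ℝ) < (D : ℝ) ^ 2 - 1 := by nlinarith
  have h0 : (0 : ℝ) < D := by linarith
  have e : ((D : ℂ) ^ 2 - 1) = (((D : ℝ) ^ 2 - 1 : ℝ) : ℂ) := by push_cast; rfl
  have hn : ‖((D : ℂ) ^ 2 - 1)‖ = (D : ℝ) ^ 2 - 1 := by
    rw [e, Complex.norm_real, Real.norm_eq_abs, abs_of_pos h1]
  by_cases hst : s = t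
  · simp only [weingarten, hst, if_true, norm_div, norm_one, hn, ne_eq, not_true_eq_false,
      if_false, pow_zero, mul_one]
    field_simp
  · simp only [weingarten, hst, if_false, norm_div, norm_neg, norm_one, norm_mul, hn, ne_eq,
      not_false_eq_true, if_true, pow_one, Complex.norm_natCast]
    field_simp

theorem average_purity_le (T : HoloNetwork) (hν : 0 < ν) (A : Finset T.Output) :
    T.average P F (fun U => (purity (T.state U) A).re) ≤
      ((((2 : ℝ) ^ ν) ^ 3) ^ 2 / ((((2 : ℝ) ^ ν) ^ 3) ^ 2 - 1)) ^ T.patch.card *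
        ∑ g : T.Spins, ((2 : ℝ) ^ ν)⁻¹ ^ T.energy A g := by
  rw [average_purity_eq P F T hν A]
  refine (Complex.re_le_norm _).trans ?_
  rw [norm_mul]
  set χ : ℝ := (2 : ℝ) ^ ν with hχ
  have hχ0 : 0 < χ := by positivity
  have hb : ‖(bellWeight ν ^ T.numBell) ^ 4‖ = (χ⁻¹) ^ (2 * T.numBell) := by
    rw [← pow_mul, show T.numBell * 4 = 2 * (2 * T.numBell) by ring, pow_mul, bellWeight_sq,
      norm_pow, norm_inv, norm_pow, Complex.norm_ofNat]
  have hD : 2 ≤ Fintype.card (Bits (GateQubits ν)) := by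
    rw [card_gateBits, ← pow_mul]
    exact Nat.le_self_pow (by omega) 2
  have hDχ : ((Fintype.card (Bits (GateQubits ν)) : ℕ) : ℝ) = χ ^ 3 := by
    rw [card_gateBits]; push_cast; rfl
  rw [hb]
  refine (mul_le_mul_of_nonneg_left (norm_sum_le _ _) (by positivity)).trans ?_
  rw [Finset.mul_sum, Finset.mul_sum]
  refine Finset.sum_le_sum fun g _ => ?_
  rw [norm_mul, norm_prod, Complex.norm_natCast]
  simp only [norm_weingarten hD, hDχ]
  rw [Finset.prod_mul_distrib, Finset.prod_const, Finset.card_univ, Fintype.card_coe,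
    Finset.prod_pow_eq_pow_sum, ← Finset.card_filter]
  change χ⁻¹ ^ (2 * T.numBell) * (((χ ^ 3) ^ 2 / ((χ ^ 3) ^ 2 - 1) * ((χ ^ 3) ^ 2)⁻¹) ^ T.patch.card *
    (χ ^ 3)⁻¹ ^ (T.flips g).card * _) ≤ _
  have hc : ((univ.filter fun p : T.Replicas ν => T.Consistent A g p).card : ℝ) ≤
      (χ ^ 2) ^ (T.numBell + 3 * T.patch.card) * χ⁻¹ ^ (T.walls A g).card := by
    have := T.card_consistent_mul_le (ν := ν) A g
    rw [T.card_bond] at this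
    rw [inv_pow, ← div_eq_mul_inv, le_div_iff₀ (by positivity)]
    rw [hχ]
    exact_mod_cast this
  have hρ : 0 ≤ (χ ^ 3) ^ 2 / ((χ ^ 3) ^ 2 - 1) := by
    rw [← hDχ]
    have h2 : (2 : ℝ) ≤ (Fintype.card (Bits (GateQubits ν)) : ℕ) := by exact_mod_cast hD
    exact div_nonneg (by positivity) (by nlinarith)
  refine (mul_le_mul_of_nonneg_left (mul_le_mul_of_nonneg_left hc (by positivity))
    (by positivity)).trans (le_of_eq ?_)
  generalize (χ ^ 3) ^ 2 / ((χ ^ 3) ^ 2 - 1) = ρ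
  rw [energy, mul_pow, pow_add, pow_add, pow_mul (χ ^ 2) 3]
  simp only [← pow_mul, inv_pow]
  field_simp

end HoloNetwork

section Split

variable {L Q B : Type} [Fintype L] [Fintype Q] [Nonempty Q] [Fintype B] [DecidableEq B]
  [DecidableEq (L → Q)]

/-- If the amplitudes are a sum of products over configurations on `B`, in which one factor depends
only on the elements satisfying `p` and the other only on those satisfying `q`, then the Schmidt
rank is bounded by the number of configurations on the elements satisfying both. -/
theorem schmidtRank_le_of_split {ψ : (L → Q) → ℂ} (A : Finset L) (bd : L → B) {κ : ℂ}
    (amp₁ amp₂ : (B → Q) → ℂ) {p q : B → Prop}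
    (hψ : ∀ x, ψ x = κ * ∑ z : B → Q, if (fun l => z (bd l)) = x then amp₁ z * amp₂ z else 0)
    (h₁ : ∀ z z', (∀ b, p b → z b = z' b) → amp₁ z = amp₁ z')
    (h₂ : ∀ z z', (∀ b, q b → z b = z' b) → amp₂ z = amp₂ z')
    (hA : ∀ l ∈ A, p (bd l)) (hA' : ∀ l, l ∉ A → q (bd l)) :
    schmidtRank ψ A ≤ Fintype.card Q ^ (univ.filter fun b => p b ∧ q b).card := by
  obtain ⟨q₀⟩ := ‹Nonempty Q›
  let res : ({b // p b} → Q) → {b // p b ∧ q b} → Q :=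
    fun z b => z ⟨b.1, b.2.1⟩
  let inner : ({b // p b} → Q) → B → Q := fun z b => if h : p b then z ⟨b, h⟩ else q₀
  let outer : ({b // p b ∧ q b} → Q) → ({b // ¬ p b} → Q) → B → Q :=
    fun s z b => if h : p b ∧ q b then s ⟨b, h⟩ else
      if h : ¬ p b then z ⟨b, h⟩ else q₀
  let f : ({l // l ∈ A} → Q) → ({b // p b} → Q) → ℂ := fun a z =>
    if ∀ l : {l // l ∈ A}, inner z (bd l.1) = a l then amp₁ (inner z) else 0
  let h : ({b // p b ∧ q b} → Q) → ({l // ¬ l ∈ A} → Q) → ℂ := fun s b =>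
    ∑ z, if ∀ l : {l // ¬ l ∈ A}, outer s z (bd l.1) = b l then amp₂ (outer s z) else 0
  have hK : Fintype.card ({b // p b ∧ q b} → Q) =
      Fintype.card Q ^ (univ.filter fun b => p b ∧ q b).card := by
    rw [Fintype.card_fun, Fintype.card_subtype]
  rw [← hK]
  refine schmidtRank_le (fun a s => κ * ∑ z, if res z = s then f a z else 0) h fun x => ?_
  simp only [mul_assoc]
  rw [← Finset.mul_sum, sum_ite_fiberwise res (f fun l => x l.1) fun s => h s fun l => x l.1,
    hψ, ← (Equiv.piEquivPiSubtypeProd p fun _ => Q).symm.sum_comp, Fintype.sum_prod_type]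
  congr 1
  refine Finset.sum_congr rfl fun z₁ _ => ?_
  rw [Finset.mul_sum]
  refine Finset.sum_congr rfl fun z₂ _ => ?_
  set z := (Equiv.piEquivPiSubtypeProd p fun _ => Q).symm (z₁, z₂) with hz
  have hin : ∀ b, p b → inner z₁ b = z b := by
    intro b hb
    simp [inner, hz, Equiv.piEquivPiSubtypeProd, hb]
  have hout : ∀ b, q b → outer (res z₁) z₂ b = z b := by
    intro b hb
    by_cases hp : p b
    · simp [outer, hz, Equiv.piEquivPiSubtypeProd, hp, hb, res]
    · simp [outer, hz, Equiv.piEquivPiSubtypeProd, hp]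
  have hiff : (fun l => z (bd l)) = x ↔ (∀ l : {l // l ∈ A}, inner z₁ (bd l.1) = x l.1) ∧
      ∀ l : {l // ¬ l ∈ A}, outer (res z₁) z₂ (bd l.1) = x l.1 := by
    constructor
    · rintro rfl
      exact ⟨fun l => hin _ (hA l.1 l.2), fun l => hout _ (hA' l.1 l.2)⟩
    · rintro ⟨h3, h4⟩
      funext l
      by_cases hl : l ∈ A
      · rw [← hin _ (hA l hl)]
        exact h3 ⟨l, hl⟩
      · rw [← hout _ (hA' l hl)]
        exact h4 ⟨l, hl⟩
  simp only [f]
  by_cases e1 : ∀ l : {l // l ∈ A}, inner z₁ (bd l.1) = x l.1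
  · by_cases e2 : ∀ l : {l // ¬ l ∈ A}, outer (res z₁) z₂ (bd l.1) = x l.1
    · rw [if_pos (hiff.mpr ⟨e1, e2⟩), if_pos e1, if_pos e2, h₁ _ _ hin, h₂ _ _ hout]
    · rw [if_neg (fun e => e2 (hiff.mp e).2), if_neg e2, mul_zero]
  · rw [if_neg (fun e => e1 (hiff.mp e).1), if_neg e1, zero_mul]

end Split

namespace HoloNetwork

/-! ### Domain walls and cuts -/

variable {ν : ℕ}

theorem eq_of_bond_eq_output (T : HoloNetwork) (l : T.Output) {l' : T.Leg}
    (h : T.bond l.1 = T.bond l') : l' = l.1 := by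
  rcases T.bond_eq_iff.mp h with h | ⟨h, -⟩
  · exact h
  · exact absurd (h ▸ l'.1.2) l.2

theorem hasSpin_output (T : HoloNetwork) (A : Finset T.Output) (g : T.Spins) (l : T.Output)
    (s : Bool) :
    T.HasSpin A g (T.bond l.1) s ↔ T.legSpin g l.1 = s ∨ decide (l ∈ A) = s := by
  constructor
  · rintro (⟨l', h, h'⟩ | ⟨l', h, h'⟩)
    · rw [T.eq_of_bond_eq_output l h.symm] at h'
      exact Or.inl h'
    · rw [Subtype.ext (T.eq_of_bond_eq_output l h.symm)] at h'
      exact Or.inr h'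
  · rintro (h | h)
    · exact Or.inl ⟨_, rfl, h⟩
    · exact Or.inr ⟨_, rfl, h⟩

theorem hasSpin_internal (T : HoloNetwork) (A : Finset T.Output) (g : T.Spins) (l : T.Leg)
    (hl : neighbor l.1.1 l.2 ∈ T.patch) (s : Bool) :
    T.HasSpin A g (T.bond l) s ↔
      T.legSpin g l = s ∨ T.legSpin g (⟨neighbor l.1.1 l.2, hl⟩, l.2) = s := by
  constructor
  · rintro (⟨l', h, h'⟩ | ⟨l', h, h'⟩)
    · rcases T.bond_eq_iff.mp h.symm with h1 | ⟨h1, h2⟩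
      · rw [h1] at h'
        exact Or.inl h'
      · rw [show l' = (⟨neighbor l.1.1 l.2, hl⟩, l.2) from Prod.ext (Subtype.ext h1) h2] at h'
        exact Or.inr h'
    · have h1 := T.eq_of_bond_eq_output l' h
      rw [h1] at hl
      exact absurd hl l'.2
  · rintro (h | h)
    · exact Or.inl ⟨_, rfl, h⟩
    · exact Or.inl ⟨_, T.bond_neighbor l hl, h⟩

theorem bond_output_mem_walls (T : HoloNetwork) (A : Finset T.Output) (g : T.Spins)
    (l : T.Output) : T.bond l.1 ∈ T.walls A g ↔ T.legSpin g l.1 ≠ decide (l ∈ A) := by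
  rw [walls, mem_filter, T.hasSpin_output, T.hasSpin_output]
  generalize T.legSpin g l.1 = s
  generalize decide (l ∈ A) = t
  cases s <;> cases t <;> simp

theorem bond_internal_mem_walls (T : HoloNetwork) (A : Finset T.Output) (g : T.Spins)
    (l : T.Leg) (hl : neighbor l.1.1 l.2 ∈ T.patch) :
    T.bond l ∈ T.walls A g ↔
      T.legSpin g l ≠ T.legSpin g (⟨neighbor l.1.1 l.2, hl⟩, l.2) := by
  rw [walls, mem_filter, T.hasSpin_internal A g l hl, T.hasSpin_internal A g l hl]
  generalize T.legSpin g l = s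
  generalize T.legSpin g (⟨neighbor l.1.1 l.2, hl⟩, l.2) = t
  cases s <;> cases t <;> simp

/-- The spins of the gates are `true` on `R` and `false` elsewhere. -/
def regionSpins (T : HoloNetwork) (R : Finset {v // v ∈ T.patch}) : T.Spins :=
  fun v => (decide (v ∈ R), decide (v ∈ R))

theorem legSpin_regionSpins (T : HoloNetwork) (R : Finset {v // v ∈ T.patch}) (l : T.Leg) :
    T.legSpin (T.regionSpins R) l = decide (l.1 ∈ R) := by
  unfold legSpin regionSpins
  split_ifs <;> rfl

theorem card_walls_regionSpins (T : HoloNetwork) (A : Finset T.Output)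
    (R : Finset {v // v ∈ T.patch}) : (T.walls A (T.regionSpins R)).card = T.cutSize A R := by
  have hint : ∀ (l : T.Leg) (hl : neighbor l.1.1 l.2 ∈ T.patch),
      T.bond l ∈ T.walls A (T.regionSpins R) ↔ ¬ (l.1 ∈ R ↔ ⟨neighbor l.1.1 l.2, hl⟩ ∈ R) := by
    intro l hl
    rw [T.bond_internal_mem_walls A _ l hl, legSpin_regionSpins, legSpin_regionSpins, ne_eq,
      decide_eq_decide]
  have hout : ∀ l : T.Output, T.bond l.1 ∈ T.walls A (T.regionSpins R) ↔
      ¬ (l ∈ A ↔ l.1.1 ∈ R) := by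
    intro l
    rw [T.bond_output_mem_walls, legSpin_regionSpins, ne_eq, decide_eq_decide]
    exact not_congr ⟨Iff.symm, Iff.symm⟩
  have hunion : T.walls A (T.regionSpins R) =
      (univ.filter fun l : T.Leg => l.1 ∈ R ∧ ∃ h : neighbor l.1.1 l.2 ∈ T.patch,
        ⟨neighbor l.1.1 l.2, h⟩ ∉ R).image T.bond ∪
      (univ.filter fun l : T.Output => ¬ (l ∈ A ↔ l.1.1 ∈ R)).image fun l => T.bond l.1 := by
    ext b
    simp only [mem_union, mem_image, mem_filter, mem_univ, true_and]
    constructor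
    · intro hb
      obtain ⟨l, rfl⟩ := T.bond_surjective b
      by_cases hl : neighbor l.1.1 l.2 ∈ T.patch
      · left
        have h1 := (hint l hl).mp hb
        by_cases hR : l.1 ∈ R
        · exact ⟨l, ⟨hR, hl, fun h => h1 (iff_of_true hR h)⟩, rfl⟩
        · refine ⟨(⟨neighbor l.1.1 l.2, hl⟩, l.2), ⟨by tauto, ?_⟩, T.bond_neighbor l hl⟩
          have h2 : neighbor (neighbor l.1.1 l.2) l.2 = l.1.1 := neighbor_neighbor _ _
          exact ⟨by rw [h2]; exact l.1.2, by simpa only [h2] using hR⟩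
      · exact Or.inr ⟨⟨l, hl⟩, (hout ⟨l, hl⟩).mp hb, rfl⟩
    · rintro (⟨l, ⟨h1, h2, h3⟩, rfl⟩ | ⟨l, h, rfl⟩)
      · exact (hint l h2).mpr fun h => h3 (h.mp h1)
      · exact (hout l).mpr h
  rw [hunion, Finset.card_union_of_disjoint, Finset.card_image_of_injOn,
    Finset.card_image_of_injective, cutSize]
  · intro l l' h
    exact Subtype.ext (T.eq_of_bond_eq_output l h).symm
  · intro l hl l' hl' h
    simp only [coe_filter, mem_univ, true_and, Set.mem_ofPred_eq] at hl hl'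
    rcases T.bond_eq_iff.mp h with h1 | ⟨h1, -⟩
    · exact h1.symm
    · obtain ⟨-, h2, h3⟩ := hl
      exact absurd (show (⟨neighbor l.1.1 l.2, h2⟩ : {v // v ∈ T.patch}) ∈ R by
        rw [show (⟨neighbor l.1.1 l.2, h2⟩ : {v // v ∈ T.patch}) = l'.1 from Subtype.ext h1.symm]
        exact hl'.1) h3
  · rw [Finset.disjoint_left]
    intro b hb hb'
    simp only [mem_image, mem_filter, mem_univ, true_and] at hb hb'
    obtain ⟨l, ⟨-, h1, -⟩, rfl⟩ := hb
    obtain ⟨l', -, h⟩ := hb'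
    rw [T.eq_of_bond_eq_output l' h] at h1
    exact l'.2 h1

theorem minCut_le_cutSize (T : HoloNetwork) (A : Finset T.Output)
    (R : Finset {v // v ∈ T.patch}) : T.minCut A ≤ T.cutSize A R :=
  ciInf_le (OrderBot.bddBelow _) R

theorem exists_cutSize_eq_minCut (T : HoloNetwork) (A : Finset T.Output) :
    ∃ R, T.cutSize A R = T.minCut A :=
  exists_eq_ciInf_of_finite

/-- The energy is at least the size of the minimal cut. -/
theorem minCut_le_energy (T : HoloNetwork) (A : Finset T.Output) (g : T.Spins) :
    T.minCut A ≤ T.energy A g := by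
  let R : Finset {v // v ∈ T.patch} := univ.filter fun v => (g v).1 = true
  have hR : ∀ l : T.Leg, ¬ (T.IsInput l ∧ l.1 ∈ T.flips g) →
      T.legSpin (T.regionSpins R) l = T.legSpin g l := by
    intro l hl
    rw [legSpin_regionSpins]
    have h1 : decide (l.1 ∈ R) = (g l.1).1 := by simp [R]
    rw [h1, legSpin]
    split_ifs with hi
    · by_contra hne
      exact hl ⟨hi, by simpa [flips] using hne⟩
    · rfl
  have hsub : T.walls A (T.regionSpins R) ⊆ T.walls A g ∪
      (T.flips g ×ˢ (univ : Finset (Fin 3))).image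
        fun p => T.bond (p.1, T.leg p.1.1 (Sum.inl p.2)) := by
    intro b hb
    rw [mem_union]
    by_cases hf : ∃ l : T.Leg, T.bond l = b ∧ T.IsInput l ∧ l.1 ∈ T.flips g
    · right
      obtain ⟨l, rfl, ⟨k, hk⟩, hl⟩ := hf
      exact mem_image.mpr ⟨(l.1, k), mem_product.mpr ⟨hl, mem_univ _⟩,
        congrArg T.bond (Prod.ext rfl hk)⟩
    · left
      have hs : ∀ s, T.HasSpin A (T.regionSpins R) b s → T.HasSpin A g b s := by
        rintro s (⟨l, h, h'⟩ | h)
        · rw [hR l fun e => hf ⟨l, h, e⟩] at h'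
          exact Or.inl ⟨l, h, h'⟩
        · exact Or.inr h
      rw [walls, mem_filter] at hb ⊢
      exact ⟨mem_univ _, hs _ hb.2.1, hs _ hb.2.2⟩
  calc T.minCut A ≤ T.cutSize A R := T.minCut_le_cutSize A R
    _ = (T.walls A (T.regionSpins R)).card := (T.card_walls_regionSpins A R).symm
    _ ≤ _ := Finset.card_le_card hsub
    _ ≤ _ := Finset.card_union_le _ _
    _ ≤ T.energy A g := by
      refine Nat.add_le_add_left (Finset.card_image_le.trans ?_) _
      rw [Finset.card_product, Finset.card_univ, Fintype.card_fin, mul_comm]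

/-- A spin configuration is determined by its domain walls and flips. -/
theorem walls_flips_injective (T : HoloNetwork) (A : Finset T.Output) :
    Function.Injective fun g : T.Spins => (T.walls A g).disjSum (T.flips g) := by
  intro g g' h
  obtain ⟨hw, hf⟩ := Finset.disjSum_inj.mp h
  by_contra hne
  let S : Finset Hexagon := (univ.filter fun v => g v ≠ g' v).map (Function.Embedding.subtype _)
  have hS : ∀ v : {v // v ∈ T.patch}, v.1 ∈ S ↔ g v ≠ g' v := by
    intro v
    simp [S]
  have hnon : S.Nonempty := by
    obtain ⟨v, hv⟩ := Function.ne_iff.mp hne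
    exact ⟨v.1, (hS v).mpr hv⟩
  have hspin : ∀ l : T.Leg, T.legSpin g l = T.legSpin g' l ↔ l.1.1 ∉ S := by
    intro l
    have h1 : l.1 ∈ T.flips g ↔ l.1 ∈ T.flips g' := by rw [hf]
    simp only [flips, mem_filter, mem_univ, true_and] at h1
    rw [hS, not_not, legSpin, legSpin, Prod.ext_iff]
    revert h1
    generalize g l.1 = p
    generalize g' l.1 = p'
    obtain ⟨a, b⟩ := p
    obtain ⟨a', b'⟩ := p'
    split_ifs <;> cases a <;> cases b <;> cases a' <;> cases b' <;> simp
  obtain ⟨v, hv, i, hi⟩ := exists_neighbor_notMem hnon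
  have hvp : v ∈ T.patch := by
    simp only [S, mem_map, Function.Embedding.subtype_apply] at hv
    obtain ⟨w, -, rfl⟩ := hv
    exact w.2
  have hl : T.legSpin g (⟨v, hvp⟩, i) ≠ T.legSpin g' (⟨v, hvp⟩, i) :=
    fun e => (hspin _).mp e hv
  have hbool : ∀ a b c : Bool, a ≠ b → ¬ (a ≠ c ↔ b ≠ c) := by decide
  by_cases hp : neighbor v i ∈ T.patch
  · have h1 := T.bond_internal_mem_walls A g (⟨v, hvp⟩, i) hp
    have h2 := T.bond_internal_mem_walls A g' (⟨v, hvp⟩, i) hp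
    rw [hw, h2, ← (hspin (⟨neighbor v i, hp⟩, i)).mpr hi] at h1
    exact hbool _ _ _ hl h1.symm
  · have h1 := T.bond_output_mem_walls A g ⟨(⟨v, hvp⟩, i), hp⟩
    have h2 := T.bond_output_mem_walls A g' ⟨(⟨v, hvp⟩, i), hp⟩
    rw [hw, h2] at h1
    exact hbool _ _ _ hl h1.symm

/-! ### The Schmidt rank -/

theorem schmidtRank_state_le (T : HoloNetwork)
    (U : {v // v ∈ T.patch} → Matrix (Bits (GateQubits ν)) (Bits (GateQubits ν)) ℂ)
    (A : Finset T.Output) (R : Finset {v // v ∈ T.patch}) :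
    schmidtRank (T.state U) A ≤ (2 ^ ν) ^ T.cutSize A R := by
  have h := schmidtRank_le_of_split (ψ := T.state U) A (fun l : T.Output => T.bond l.1)
    (κ := bellWeight ν ^ T.numBell)
    (fun z => ∏ v ∈ R, U v (T.outState (z ∘ T.bond) v) (T.inState (z ∘ T.bond) v))
    (fun z => ∏ v ∈ Rᶜ, U v (T.outState (z ∘ T.bond) v) (T.inState (z ∘ T.bond) v))
    (p := fun b => T.HasSpin A (T.regionSpins R) b true)
    (q := fun b => T.HasSpin A (T.regionSpins R) b false) ?_ ?_ ?_ ?_ ?_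
  · rw [card_qudit] at h
    rwa [← T.card_walls_regionSpins]
  · intro x
    simp only [Finset.prod_mul_prod_compl]
    exact T.state_eq_sum U x
  · intro z z' hz
    refine Finset.prod_congr rfl fun v hv => ?_
    have h1 : ∀ i, z (T.bond (v, i)) = z' (T.bond (v, i)) := fun i =>
      hz _ (Or.inl ⟨(v, i), rfl, by rw [T.legSpin_regionSpins, decide_eq_true hv]⟩)
    congr 1
    · funext q
      simp only [outState, Function.comp_apply, h1]
    · funext q
      simp only [inState, Function.comp_apply, h1]
  · intro z z' hz
    refine Finset.prod_congr rfl fun v hv => ?_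
    have h1 : ∀ i, z (T.bond (v, i)) = z' (T.bond (v, i)) := fun i =>
      hz _ (Or.inl ⟨(v, i), rfl, by
        rw [T.legSpin_regionSpins, decide_eq_false (mem_compl.mp hv)]⟩)
    congr 1
    · funext q
      simp only [outState, Function.comp_apply, h1]
    · funext q
      simp only [inState, Function.comp_apply, h1]
  · exact fun l hl => Or.inr ⟨l, rfl, decide_eq_true hl⟩
  · exact fun l hl => Or.inr ⟨l, rfl, decide_eq_false hl⟩

end HoloNetwork

/-! ### Estimates -/

theorem sum_pow_card_le {I N : Type*} [Fintype I] [Fintype N] {Φ : I → Finset N}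
    (hΦ : Function.Injective Φ) {y : ℝ} (hy : 0 ≤ y) :
    ∑ i, y ^ (Φ i).card ≤ Real.exp (Fintype.card N * y) := by
  have h1 : ∑ i, y ^ (Φ i).card ≤ ∑ S : Finset N, y ^ S.card := by
    rw [← Finset.sum_image (f := fun S : Finset N => y ^ S.card) (s := univ) (g := Φ)
      fun _ _ _ _ h => hΦ h]
    exact Finset.sum_le_sum_of_subset_of_nonneg (subset_univ _) fun _ _ _ => by positivity
  refine h1.trans ?_
  have h2 := Fintype.sum_pow_mul_eq_add_pow N y 1
  simp only [one_pow, mul_one] at h2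
  rw [h2, Real.exp_nat_mul]
  exact pow_le_pow_left₀ (by positivity) (Real.add_one_le_exp y) _

theorem sum_inv_pow_le {I N : Type*} [Fintype I] [Fintype N] [Nonempty N] {Φ : I → Finset N}
    (hΦ : Function.Injective Φ) {e : I → ℕ} {γ : ℕ} (hγ : ∀ i, γ ≤ e i)
    (he : ∀ i, (Φ i).card ≤ e i) {χ : ℝ} (hχ : (Fintype.card N : ℝ) ≤ χ) :
    ∑ i, χ⁻¹ ^ e i ≤ (Fintype.card N / χ) ^ γ * Real.exp 1 := by
  set n : ℝ := (Fintype.card N : ℝ) with hn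
  have hn1 : 1 ≤ n := by
    rw [hn]; exact_mod_cast (Fintype.card_pos : 0 < Fintype.card N)
  have hn0 : 0 < n := by linarith
  have hχ0 : 0 < χ := by linarith
  have h1 : ∀ i, χ⁻¹ ^ e i ≤ (n / χ) ^ γ * n⁻¹ ^ (Φ i).card := by
    intro i
    have ha : χ⁻¹ ^ e i ≤ χ⁻¹ ^ max γ (Φ i).card :=
      pow_le_pow_of_le_one (by positivity) (inv_le_one_of_one_le₀ (hn1.trans hχ))
        (max_le (hγ i) (he i))
    refine ha.trans ?_
    rcases le_total γ (Φ i).card with h | h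
    · rw [max_eq_right h]
      obtain ⟨d, hd⟩ := Nat.exists_eq_add_of_le h
      rw [hd, pow_add, pow_add, div_eq_mul_inv, mul_pow, inv_pow n γ]
      have hb : χ⁻¹ ^ d ≤ n⁻¹ ^ d :=
        pow_le_pow_left₀ (by positivity) (inv_anti₀ hn0 hχ) _
      have hc : n ^ γ * χ⁻¹ ^ γ * ((n ^ γ)⁻¹ * n⁻¹ ^ d) = χ⁻¹ ^ γ * n⁻¹ ^ d := by
        field_simp
      rw [hc]
      exact mul_le_mul_of_nonneg_left hb (by positivity)
    · rw [max_eq_left h]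
      obtain ⟨d, hd⟩ := Nat.exists_eq_add_of_le h
      have hc : (n / χ) ^ γ * n⁻¹ ^ (Φ i).card = χ⁻¹ ^ γ * n ^ d := by
        rw [div_eq_mul_inv, mul_pow]
        nth_rw 1 [hd]
        rw [pow_add, inv_pow n]
        field_simp
      rw [hc]
      exact le_mul_of_one_le_right (by positivity) (one_le_pow₀ hn1)
  refine (Finset.sum_le_sum fun i _ => h1 i).trans ?_
  rw [← Finset.mul_sum]
  refine mul_le_mul_of_nonneg_left ((sum_pow_card_le hΦ (by positivity)).trans ?_) (by positivity)
  rw [← hn, mul_inv_cancel₀ hn0.ne']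

namespace HoloNetwork

variable {ν : ℕ}

/-- Bonds and gates: the places at which a spin configuration costs energy. -/
abbrev Defect (T : HoloNetwork) : Type := T.Bond ⊕ {v // v ∈ T.patch}

theorem patch_nonempty (T : HoloNetwork) (h : 0 < T.numQubits ν) : T.patch.Nonempty := by
  obtain ⟨l⟩ := Fintype.card_pos_iff.mp (Nat.pos_of_ne_zero fun h0 => by
    rw [numQubits, h0, zero_mul] at h
    exact h.false)
  exact ⟨_, l.1.1.2⟩

theorem card_defect_le (T : HoloNetwork) (hν : 0 < ν) :
    Fintype.card T.Defect ≤ 7 * T.numQubits ν := by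
  have h1 := T.card_bond_le
  have h2 := T.card_patch_le_card_output
  have h3 : Fintype.card T.Output ≤ T.numQubits ν := Nat.le_mul_of_pos_right _ hν
  rw [Fintype.card_sum, Fintype.card_coe T.patch]
  omega

theorem card_le_energy (T : HoloNetwork) (A : Finset T.Output) (g : T.Spins) :
    ((T.walls A g).disjSum (T.flips g)).card ≤ T.energy A g := by
  rw [Finset.card_disjSum, energy]
  omega

variable (P : PMF (Equiv.Perm (Bits (GateQubits ν)))) (F : PMF (Bits (GateQubits ν) → ZMod 2))

theorem expectedEntropy_le (T : HoloNetwork) (hν : 0 < ν) (A : Finset T.Output) :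
    T.expectedEntropy P F A ≤ T.minCut A * Real.log ((2 : ℝ) ^ ν) := by
  obtain ⟨R, hR⟩ := T.exists_cutSize_eq_minCut A
  have hm : 0 < (2 ^ ν) ^ T.cutSize A R := by positivity
  rw [expectedEntropy_eq_average]
  refine (T.average_mono P F fun U =>
    entanglementEntropy_le (T.state U) A hm (T.schmidtRank_state_le U A R)).trans ?_
  have h1 : (fun U => (reducedTrace (T.state U) A).re * Real.log (((2 ^ ν) ^ T.cutSize A R : ℕ) : ℝ)
      + 1 - (reducedTrace (T.state U) A).re) = fun U =>
      (Real.log (((2 ^ ν) ^ T.cutSize A R : ℕ) : ℝ) - 1) * (reducedTrace (T.state (ν := ν) U) A).re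
        + 1 := by
    funext U
    ring
  rw [h1, T.average_add P F (fun U => (Real.log (((2 ^ ν) ^ T.cutSize A R : ℕ) : ℝ) - 1) *
    (reducedTrace (T.state U) A).re) fun _ => 1, T.average_const, T.average_const_mul P F,
    T.average_reducedTrace P F hν A, hR]
  push_cast
  rw [Real.log_pow]
  linarith

theorem neg_log_le_expectedEntropy (T : HoloNetwork) (hν : 0 < ν) (A : Finset T.Output) {t : ℝ}
    (ht : 0 < t) (h : T.average P F (fun U => (purity (T.state U) A).re) ≤ t) :
    -Real.log t ≤ T.expectedEntropy P F A := by
  rw [expectedEntropy_eq_average]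
  refine le_trans ?_ (T.average_mono P F fun U => le_entanglementEntropy (T.state U) A ht)
  have h1 : (fun U => (1 - Real.log t) * (reducedTrace (T.state U) A).re -
      (purity (T.state U) A).re / t) = fun U =>
      (1 - Real.log t) * (reducedTrace (T.state (ν := ν) U) A).re +
        (-t⁻¹) * (purity (T.state U) A).re := by
    funext U
    ring
  rw [h1, T.average_add P F (fun U => (1 - Real.log t) * (reducedTrace (T.state U) A).re)
    fun U => (-t⁻¹) * (purity (T.state U) A).re, T.average_const_mul P F, T.average_const_mul P F,
    T.average_reducedTrace P F hν A]
  have h2 : t⁻¹ * T.average P F (fun U => (purity (T.state U) A).re) ≤ 1 := by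
    rw [inv_mul_le_iff₀ ht, mul_one]
    exact h
  linarith

theorem weingarten_correction_le {χ : ℝ} (hχ : 2 ≤ χ) (V : ℕ) :
    ((χ ^ 3) ^ 2 / ((χ ^ 3) ^ 2 - 1)) ^ V ≤ Real.exp (V * χ⁻¹) := by
  have h1 : χ + 1 ≤ (χ ^ 3) ^ 2 := by
    have h2 : (2 : ℝ) ^ 5 ≤ χ ^ 5 := pow_le_pow_left₀ (by norm_num) hχ 5
    nlinarith
  rw [Real.exp_nat_mul]
  refine pow_le_pow_left₀ (div_nonneg (by positivity) (by linarith)) ?_ _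
  refine le_trans ?_ (Real.add_one_le_exp _)
  rw [div_le_iff₀ (by linarith)]
  have h3 : χ⁻¹ * χ = 1 := inv_mul_cancel₀ (by linarith)
  have h4 : 0 < χ⁻¹ := by positivity
  nlinarith

theorem two_le_two_pow (hν : 0 < ν) : (2 : ℝ) ≤ (2 : ℝ) ^ ν := by
  have := Nat.le_self_pow hν.ne' 2
  exact_mod_cast this

theorem neg_le_expectedEntropy (T : HoloNetwork) (hν : 0 < ν) (A : Finset T.Output) :
    -(8 * ((T.numQubits ν : ℝ) / (2 : ℝ) ^ ν)) ≤ T.expectedEntropy P F A := by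
  have hχ := two_le_two_pow hν
  set χ : ℝ := (2 : ℝ) ^ ν with hχd
  have h1 : ∑ g : T.Spins, χ⁻¹ ^ T.energy A g ≤ Real.exp (Fintype.card T.Defect * χ⁻¹) :=
    (Finset.sum_le_sum fun g _ => pow_le_pow_of_le_one (by positivity)
      (inv_le_one_of_one_le₀ (by linarith)) (T.card_le_energy A g)).trans
      (sum_pow_card_le (T.walls_flips_injective A) (by positivity))
  have h2 := T.average_purity_le P F hν A
  have h3 := h2.trans (mul_le_mul (weingarten_correction_le hχ T.patch.card) h1
    (by positivity) (by positivity))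
  rw [← Real.exp_add] at h3
  have h4 := T.neg_log_le_expectedEntropy P F hν A (Real.exp_pos _) h3
  rw [Real.log_exp] at h4
  refine le_trans ?_ h4
  have h5 : (Fintype.card T.Defect : ℝ) ≤ 7 * T.numQubits ν := by
    exact_mod_cast T.card_defect_le hν
  have h6 : (T.patch.card : ℝ) ≤ T.numQubits ν := by
    exact_mod_cast T.card_patch_le_card_output.trans (Nat.le_mul_of_pos_right _ hν)
  rw [div_eq_mul_inv]
  have h7 : 0 < χ⁻¹ := by positivity
  nlinarith

theorem le_expectedEntropy (T : HoloNetwork) (hν : 0 < ν) (A : Finset T.Output)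
    (hT : T.patch.Nonempty) (h : 7 * (T.numQubits ν : ℝ) ≤ (2 : ℝ) ^ ν) :
    T.minCut A * (Real.log ((2 : ℝ) ^ ν) - Real.log (7 * T.numQubits ν)) - 2 ≤
      T.expectedEntropy P F A := by
  have hχ := two_le_two_pow hν
  set χ : ℝ := (2 : ℝ) ^ ν with hχd
  have h5 : (Fintype.card T.Defect : ℝ) ≤ 7 * T.numQubits ν := by
    exact_mod_cast T.card_defect_le hν
  have h6 : (T.patch.card : ℝ) ≤ T.numQubits ν := by
    exact_mod_cast T.card_patch_le_card_output.trans (Nat.le_mul_of_pos_right _ hν)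
  obtain ⟨v, hv⟩ := hT
  have : Nonempty T.Defect := ⟨Sum.inr ⟨v, hv⟩⟩
  have hn : (0 : ℝ) < Fintype.card T.Defect := by
    exact_mod_cast (Fintype.card_pos : 0 < Fintype.card T.Defect)
  have hχ0 : 0 < χ := by linarith
  have h1 := sum_inv_pow_le (T.walls_flips_injective A) (T.minCut_le_energy A)
    (T.card_le_energy A) (h5.trans h)
  have h2 := T.average_purity_le P F hν A
  have h3 : ((χ ^ 3) ^ 2 / ((χ ^ 3) ^ 2 - 1)) ^ T.patch.card ≤ Real.exp 1 := by
    refine (weingarten_correction_le hχ _).trans (Real.exp_le_exp.mpr ?_)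
    rw [← div_eq_mul_inv, div_le_one hχ0]
    have : (0 : ℝ) ≤ T.numQubits ν := Nat.cast_nonneg _
    linarith
  have h4 := h2.trans (mul_le_mul h3 h1 (by positivity) (by positivity))
  have h7 := T.neg_log_le_expectedEntropy P F hν A (by positivity) h4
  refine le_trans ?_ h7
  have hq : (0 : ℝ) < (Fintype.card T.Defect / χ) ^ T.minCut A := by positivity
  rw [Real.log_mul (Real.exp_pos _).ne' (by positivity), Real.log_mul hq.ne' (Real.exp_pos _).ne',
    Real.log_pow _ (T.minCut A), Real.log_exp, Real.log_div hn.ne' hχ0.ne']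
  have h8 : Real.log (Fintype.card T.Defect) ≤ Real.log (7 * T.numQubits ν) :=
    Real.log_le_log hn h5
  have h9 : (T.minCut A : ℝ) * Real.log (Fintype.card T.Defect) ≤
      T.minCut A * Real.log (7 * T.numQubits ν) :=
    mul_le_mul_of_nonneg_left h8 (Nat.cast_nonneg _)
  linarith

/-- The correction to the Ryu–Takayanagi formula is small if `χ` is superpolynomial in `N`. -/
theorem log_add_two_le {N M : ℕ} {χ ε : ℝ} (hM : 56 ≤ M) (hMε : 2 ≤ ε * M) (hN : M ≤ N)
    (hχ : (N : ℝ) ^ M ≤ χ) :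
    7 * (N : ℝ) ≤ χ ∧ Real.log (7 * N) + 2 ≤ ε * Real.log χ := by
  have hN56 : (56 : ℝ) ≤ N := by exact_mod_cast hM.trans hN
  have hM0 : (0 : ℝ) < M := by exact_mod_cast (by omega : 0 < M)
  have hε : 0 < ε := by
    by_contra hneg
    nlinarith
  constructor
  · have h1 : (N : ℝ) ^ 2 ≤ (N : ℝ) ^ M := pow_le_pow_right₀ (by linarith) (by omega)
    nlinarith
  · have h1 : (2 : ℝ) ≤ Real.log 8 := by
      rw [show (8 : ℝ) = 2 ^ 3 by norm_num, Real.log_pow]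
      have := Real.log_two_gt_d9
      push_cast
      linarith
    have h2 : Real.log (7 * N) + Real.log 8 ≤ 2 * Real.log N := by
      rw [← Real.log_mul (by linarith) (by norm_num), ← Real.log_rpow (by linarith)]
      refine Real.log_le_log (by linarith) ?_
      rw [Real.rpow_two]
      nlinarith
    have h3 : (M : ℝ) * Real.log N ≤ Real.log χ := by
      rw [← Real.log_pow]
      exact Real.log_le_log (pow_pos (by linarith) _) hχ
    have h4 : 0 ≤ Real.log N := Real.log_nonneg (by linarith)
    nlinarith

end HoloNetwork

end

theorem theorem2 :
    ∃ C : ℝ, ∀ ε : ℝ, 0 < ε → ∃ M : ℕ,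
      ∀ (T : HoloNetwork) (ν : ℕ)
        (P : PMF (Equiv.Perm (Bits (HoloNetwork.GateQubits ν))))
        (F : PMF (Bits (HoloNetwork.GateQubits ν) → ZMod 2))
        (A : Finset T.Output),
        M ≤ T.numQubits ν → (T.numQubits ν) ^ M ≤ 2 ^ ν →
          ∃ δ r : ℝ, |δ| ≤ ε ∧ |r| ≤ C * ((T.numQubits ν : ℝ) / (2 : ℝ) ^ ν) ∧
            T.expectedEntropy P F A =
              (T.minCut A : ℝ) * Real.log ((2 : ℝ) ^ ν) * (1 + δ) + r := by
  refine ⟨8, fun ε hε => ⟨max 56 ⌈2 / ε⌉₊, fun T ν P F A hN hχ => ?_⟩⟩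
  set M := max 56 ⌈2 / ε⌉₊ with hM
  have hM56 : 56 ≤ M := le_max_left _ _
  have hN0 : 0 < T.numQubits ν := by omega
  have hν : 0 < ν := Nat.pos_of_ne_zero fun h => by simp [HoloNetwork.numQubits, h] at hN0
  have hMε : 2 ≤ ε * M := by
    have h1 : 2 / ε ≤ M := (Nat.le_ceil _).trans (by exact_mod_cast le_max_right _ _)
    rwa [div_le_iff₀ hε, mul_comm] at h1
  have hT : T.patch.Nonempty := T.patch_nonempty hN0
  obtain ⟨h7, hlog⟩ := HoloNetwork.log_add_two_le hM56 hMε hN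
    (χ := (2 : ℝ) ^ ν) (by exact_mod_cast hχ)
  have hle := HoloNetwork.expectedEntropy_le P F T hν A
  have hpos : 0 ≤ (T.numQubits ν : ℝ) / (2 : ℝ) ^ ν := by positivity
  rcases Nat.eq_zero_or_pos (T.minCut A) with hγ | hγ
  · have hge := HoloNetwork.neg_le_expectedEntropy P F T hν A
    rw [hγ, Nat.cast_zero, zero_mul] at hle
    refine ⟨0, T.expectedEntropy P F A, by simpa using hε.le, ?_, by rw [hγ]; simp⟩
    rw [abs_le]
    exact ⟨hge, hle.trans (by positivity)⟩
  · have hge := HoloNetwork.le_expectedEntropy P F T hν A hT h7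
    have hχ1 : 0 < Real.log ((2 : ℝ) ^ ν) :=
      Real.log_pos (by linarith [HoloNetwork.two_le_two_pow hν])
    have hγ1 : (1 : ℝ) ≤ T.minCut A := by exact_mod_cast hγ
    have hx : 0 < (T.minCut A : ℝ) * Real.log ((2 : ℝ) ^ ν) := by positivity
    refine ⟨(T.expectedEntropy P F A - T.minCut A * Real.log ((2 : ℝ) ^ ν)) /
      (T.minCut A * Real.log ((2 : ℝ) ^ ν)), 0, ?_, by simpa using by positivity, ?_⟩
    · rw [abs_le, le_div_iff₀ hx, div_le_iff₀ hx]
      constructor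
      · nlinarith
      · nlinarith
    · field_simp
      ring
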